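/- Let $k$ be a field, $R$ a commutative $k$-algebra, $\mathfrak D=\mathrm{Der}_k(R)$, and let $\nabla$ be a connection on $\mathfrak D$: a map $(E,F)\mapsto\nabla_EF\in\mathfrak D$, additive in $E$ and in $F$, with $\nabla_{fE}F=f\nabla_EF$ and $\nabla_E(fF)=f\nabla_EF+E(f)F$ for $f\in R$. Let $\mathfrak S\subseteq\mathfrak D$. For a set $L$ let $k\mathrm{LT}(L)$ be the vector space with basis the ordered rooted trees whose non-root nodes are labelled by $L$. The product $T_1\cdot T_2$ is the sum, over all maps $d$ from the children of the root of $T_1$ to the nodes of $T_2$, of the trees obtained by removing the root of $T_1$ and linking each of its children $c$ (with its branch) to the node $d(c)$, in the original order and before the children already there. The coproduct of a tree is the sum over all ways of distributing the branches at its root over two trees, and the counit is $1$ on the one-node tree and $0$ on all others. Let $\mathrm v(E)$ be the tree whose root has a single child, a leaf labelled $E$, and let $\mathrm u(E;T)$ be the tree whose root has a single child, labelled $E$, with which the root of $T$ is identified. Let $F(\mathfrak S)$ be the free associative $k$-algebra on $\mathfrak S$, and $\mathrm{Diff}_k(\mathfrak S)$ the subalgebra of the enveloping algebra $U(\mathfrak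 D)$ generated by $\mathfrak S$; in both, and in $U(\mathfrak D)$, the derivations are primitive. All these act on $R$, derivations acting as themselves, and trees as follows. (1) There is exactly one action $\psi$ of the algebra $k\mathrm{LT}(\mathfrak D)$ on $R$ (a $k$-linear, unital and multiplicative map to $\mathrm{End}_k(R)$) such that $\mathrm v(E)$ acts as $E$, $\mathrm u(E;\mathrm v(F))$ acts as $\nabla_FE$, and, whenever a tree $\mathrm u(E;C)$ acts as a derivation $G$, replacing a branch $\mathrm u(E;C)$ of any tree by $\mathrm v(G)$ does not change the action of that tree. It is induced by the linear map $\Psi:k\mathrm{LT}(\mathfrak D)\to U(\mathfrak D)$ defined thus. For $E,F_1,\dots,F_n\in\mathfrak D$ put $D_0(E)=E$ and $D_n(F_1,\dots,F_n;E)=\nabla_{F_1}D_{n-1}(F_2,\dots,F_n;E)-\sum_{i=2}^nD_{n-1}(F_2,\dots,\nabla_{F_1}F_i,\dots,F_n;E)$; put $W_0=1$ and $W_n(F_1,\dots,F_n)=F_1W_{n-1}(F_2,\dots,F_n)-\sum_{i=2}^nW_{n-1}(F_2,\dots,\nabla_{F_1}F_i,\dots,F_n)$ in $U(\mathfrak D)$.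 A branch whose top node is labelled $E$ and whose sub-branches have, in order, the derivations $F_1,\dots,F_n$ has the derivation $D_n(F_1,\dots,F_n;E)$, and $\Psi(T)=W_n(F_1,\dots,F_n)$ if the branches at the root of $T$ have, in order, the derivations $F_1,\dots,F_n$. For a bialgebra $H$ acting on $R$ let $R\rtimes H$ be $R\otimes_kH$ with the product $(r\rtimes h)(s\rtimes g)=\sum_{(h)}r(h_{(1)}\cdot s)\rtimes h_{(2)}g$ and the $R$-coalgebra structure induced by that of $H$. Let $i:R\rtimes F(\mathfrak S)\to R\rtimes k\mathrm{LT}(\mathfrak S)$ and $p:R\rtimes F(\mathfrak S)\to R\rtimes\mathrm{Diff}_k(\mathfrak S)$ be the maps induced by the algebra maps with $E\mapsto\mathrm v(E)$ and $E\mapsto E$ ($E\in\mathfrak S$), and let $\varphi:R\rtimes k\mathrm{LT}(\mathfrak S)\to R\rtimes U(\mathfrak D)$ be the map $r\rtimes T\mapsto r\rtimes\Psi(T)$. (2) The maps $i$, $p$ and $\varphi$ are $R$-linear and respect units, products, coproducts over $R$ and counits. (3) The triangle commutes: $\varphi\circ i=p$, where $R\rtimes\mathrm{Diff}_k(\mathfrak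 S)$ is mapped into $R\rtimes U(\mathfrak D)$ by the inclusion. (4) If $\Psi$ maps $k\mathrm{LT}(\mathfrak S)$ into $\mathrm{Diff}_k(\mathfrak S)$, then the resulting map $\varphi:R\rtimes k\mathrm{LT}(\mathfrak S)\to R\rtimes\mathrm{Diff}_k(\mathfrak S)$ also has the properties in (2), and $\varphi\circ i=p$ as maps to $R\rtimes\mathrm{Diff}_k(\mathfrak S)$. This hypothesis holds if $\nabla_EF$ lies in the $k$-span of $\mathfrak S$ for all $E,F\in\mathfrak S$, in particular for $\mathfrak S=\mathfrak D$. -/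

import Mathlib

open scoped TensorProduct

noncomputable section

namespace ConnTree

/-- Ordered rooted trees whose nodes other than the root are labelled by elements of `L`.
`nil` is the tree with one node (the root). `cons E C U` is the tree whose root has as first child
a node labelled `E`; the subtree rooted at that node is `C` (whose unlabelled root is identified
with the node), and the remaining children of the root, in order, are those of the root of `U`. -/
inductive OTree (L : Type*) : Type _
  | nil : OTree L
  | cons : L → OTree L → OTree L → OTree L

namespace OTree

variable {L : Type*} {M : Type*}

/-- Relabelling of the nodes. -/
def map (f : L → M) : OTree L → OTree M
  | nil => nil
  | cons E C U => cons (f E) (C.map f) (U.map f)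

/-- The tree with two nodes, the child of the root being labelled `E`. -/
def v (E : L) : OTree L := cons E nil nil

/-- The tree whose root has one child, labelled `E`, with which the root of `C` is identified. -/
def u (E : L) (C : OTree L) : OTree L := cons E C nil

/-- Identify the roots of two trees; the children of the first root precede those of the second. -/
def t : OTree L → OTree L → OTree L
  | nil, V => V
  | cons E C U, V => cons E C (t U V)

/-- The children of the root; `none` is the first child, `some c` are the further ones. -/
def Child : OTree L → Type
  | nil => Empty
  | cons _ _ U => Option U.Child

/-- The nodes other than the root. In `cons E C U` these are the first child of the root
(`Sum.inl none`), the non-root nodes of `C`, and the non-root nodes of `U`. -/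
def InnerNode : OTree L → Type
  | nil => Empty
  | cons _ C U => Option C.InnerNode ⊕ U.InnerNode

/-- All the nodes; `none` is the root. -/
abbrev Node (T : OTree L) : Type := Option T.InnerNode

instance childFintype : (T : OTree L) → Fintype T.Child
  | nil => inferInstanceAs (Fintype Empty)
  | cons _ _ U =>
    haveI := childFintype U
    inferInstanceAs (Fintype (Option U.Child))

instance childDecidableEq : (T : OTree L) → DecidableEq T.Child
  | nil => inferInstanceAs (DecidableEq Empty)
  | cons _ _ U =>
    haveI := childDecidableEq U
    inferInstanceAs (DecidableEq (Option U.Child))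

instance innerNodeFintype : (T : OTree L) → Fintype T.InnerNode
  | nil => inferInstanceAs (Fintype Empty)
  | cons _ C U =>
    haveI := innerNodeFintype C
    haveI := innerNodeFintype U
    inferInstanceAs (Fintype (Option C.InnerNode ⊕ U.InnerNode))

instance innerNodeDecidableEq : (T : OTree L) → DecidableEq T.InnerNode
  | nil => inferInstanceAs (DecidableEq Empty)
  | cons _ C U =>
    haveI := innerNodeDecidableEq C
    haveI := innerNodeDecidableEq U
    inferInstanceAs (DecidableEq (Option C.InnerNode ⊕ U.InnerNode))

/-- The tree formed by a set of children of the root (those with `q c = true`), with the branches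
that they carry, linked in their original order to a root. -/
def keep : (T : OTree L) → (T.Child → Bool) → OTree L
  | nil, _ => nil
  | cons E C U, q => bif q none then cons E C (U.keep fun c => q (some c))
      else U.keep fun c => q (some c)

/-- Link, at every non-root node `n`, the children of the root of `f n` to `n`, in order and before
the children which `n` already has. -/
def attachInner : (T : OTree L) → (T.InnerNode → OTree L) → OTree L
  | nil, _ => nil
  | cons E C U, f =>
      cons E (t (f (Sum.inl none)) (C.attachInner fun n => f (Sum.inl (some n))))
        (U.attachInner fun n => f (Sum.inr n))

/-- Link, at every node `n` (the root included), the children of the root of `f n` to `n`, in order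
and before the children which `n` already has. -/
def attach (T : OTree L) (f : T.Node → OTree L) : OTree L :=
  t (f none) (T.attachInner fun n => f (some n))

/-- Remove the root of `A` and link every child `c` of it (with its branch) to the node `d c`
of `T`. Children linked to the same node keep the order they had in `A`. -/
def link (A T : OTree L) (d : A.Child → T.Node) : OTree L :=
  T.attach fun n => A.keep fun c => decide (d c = n)

end OTree

variable (k : Type*) [Field k] (L : Type*)

/-- The vector space with basis the ordered trees labelled by `L`. -/
def TreeAlg := OTree L →₀ k

instance : AddCommGroup (TreeAlg k L) := inferInstanceAs (AddCommGroup (OTree L →₀ k))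
instance : Module k (TreeAlg k L) := inferInstanceAs (Module k (OTree L →₀ k))

variable {L}
/-- A tree as an element of the vector space. -/
def tree (T : OTree L) : TreeAlg k L := Finsupp.single T 1

variable (L)
/-- The basis of trees. -/
def treeBasis : Module.Basis (OTree L) k (TreeAlg k L) := Finsupp.basisSingleOne

/-- The product of trees: the product of `A` and `T` is the sum, over all maps `d` from the children
of the root of `A` to the nodes of `T`, of the trees `A.link T d`. -/
def treeMul : TreeAlg k L →ₗ[k] TreeAlg k L →ₗ[k] TreeAlg k L :=
  (treeBasis k L).constr k fun A => (treeBasis k L).constr k fun T =>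
    ∑ d : A.Child → T.Node, tree k (A.link T d)

variable {L}
/-! Proof that the product of trees is associative and unital; only the instances which follow it
are used later. -/
namespace TreeProof
open OTree

@[simp] lemma treeBasis_apply (T : OTree L) : treeBasis k L T = tree k T := rfl

@[simp] lemma constr_tree {P : Type*} [AddCommGroup P] [Module k P] (f : OTree L → P) (T : OTree L) :
    (treeBasis k L).constr k f (tree k T) = f T :=
  (treeBasis k L).constr_basis k f T

lemma treeMul_tree (A T : OTree L) :
    treeMul k L (tree k A) (tree k T) = ∑ d : A.Child → T.Node, tree k (A.link T d) := by
  simp [treeMul]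

@[simp] lemma t_nil (T : OTree L) : t T nil = T := by
  induction T with
  | nil => rfl
  | cons E C U _ ih => simp [t, ih]

@[simp] lemma nil_t (T : OTree L) : t nil T = T := rfl

lemma t_assoc (T U V : OTree L) : t (t T U) V = t T (t U V) := by
  induction T with
  | nil => rfl
  | cons E C U _ ih => simp [t, ih]

@[simp] lemma attachInner_nil (T : OTree L) : T.attachInner (fun _ => nil) = T := by
  induction T with
  | nil => rfl
  | cons E C U ih1 ih2 => simp [attachInner, ih1, ih2]

lemma keep_true (T : OTree L) : T.keep (fun _ => true) = T := by
  induction T with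
  | nil => rfl
  | cons E C U _ ih => simp [keep, ih]

lemma one_mul' (x : TreeAlg k L) : treeMul k L (tree k nil) x = x := by
  suffices treeMul k L (tree k nil) = LinearMap.id by rw [this]; rfl
  refine (treeBasis k L).ext fun T => ?_
  rw [treeBasis_apply, treeMul_tree]
  have : Unique ((nil : OTree L).Child → T.Node) :=
    inferInstanceAs (Unique (Empty → T.Node))
  rw [Fintype.sum_unique]
  simp [link, keep, attach]

lemma mul_one' (x : TreeAlg k L) : treeMul k L x (tree k nil) = x := by
  suffices (treeMul k L).flip (tree k nil) = LinearMap.id by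
    exact congrArg (fun f => f x) this
  refine (treeBasis k L).ext fun T => ?_
  rw [treeBasis_apply, LinearMap.flip_apply, treeMul_tree]
  have : IsEmpty (nil : OTree L).InnerNode := inferInstanceAs (IsEmpty Empty)
  rw [Fintype.sum_unique]
  have : ∀ c : T.Child, (default : T.Child → (nil : OTree L).Node) c = none := fun c =>
    Subsingleton.elim _ _
  simp [link, attach, attachInner, this, keep_true]


section graft
variable (E : L) (C : OTree L)

def consL (F : L) (U : OTree L) : TreeAlg k L →ₗ[k] TreeAlg k L :=
  (treeBasis k L).constr k fun X => tree k (cons F X U)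

def consR (F : L) (B : OTree L) : TreeAlg k L →ₗ[k] TreeAlg k L :=
  (treeBasis k L).constr k fun X => tree k (cons F B X)

def graftIn : OTree L → TreeAlg k L
  | nil => 0
  | cons F B U => consL k F U (tree k (cons E C B) + graftIn B) + consR k F B (graftIn U)

variable {k} in
abbrev lin {P : Type*} [AddCommGroup P] [Module k P] (f : OTree L → P) : TreeAlg k L →ₗ[k] P :=
  (treeBasis k L).constr k f

lemma lin_comp {P Q : Type*} [AddCommGroup P] [Module k P] [AddCommGroup Q] [Module k Q]
    (f : OTree L → P) (g : P →ₗ[k] Q) (x : TreeAlg k L) :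
    g (lin (k := k) f x) = lin (k := k) (fun T => g (f T)) x := by
  have : g.comp (lin (k := k) f) = lin (k := k) (fun T => g (f T)) :=
    (treeBasis k L).ext fun T => by simp
  exact congrArg (fun h => h x) this

lemma lin_sum {P ι : Type*} [AddCommGroup P] [Module k P] (s : Finset ι)
    (f : ι → OTree L → P) (x : TreeAlg k L) :
    lin (k := k) (fun T => ∑ i ∈ s, f i T) x = ∑ i ∈ s, lin (k := k) (f i) x := by
  have : lin (k := k) (fun T => ∑ i ∈ s, f i T) = ∑ i ∈ s, lin (k := k) (f i) :=
    (treeBasis k L).ext fun T => by simp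
  rw [this, LinearMap.sum_apply]

lemma graftIn_t (P Q : OTree L) : graftIn k E C (t P Q) =
    lin (k := k) (fun X => tree k (t X Q)) (graftIn k E C P) +
      lin (k := k) (fun X => tree k (t P X)) (graftIn k E C Q) := by
  induction P with
  | nil =>
    simp only [graftIn, nil_t, map_zero, zero_add]
    have : lin (k := k) (fun X : OTree L => tree k X) = LinearMap.id :=
      (treeBasis k L).ext fun T => by simp
    rw [this]; rfl
  | cons F B U _ ih =>
    simp only [graftIn, t, ih, map_add, consL, consR, constr_tree, lin_comp]
    abel

lemma graftIn_attachInner (T : OTree L) : ∀ f : T.InnerNode → OTree L,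
    graftIn k E C (T.attachInner f) = ∑ m, lin (k := k)
      (fun X => tree k (T.attachInner (Function.update f m X)))
      (tree k (cons E C (f m)) + graftIn k E C (f m)) := by
  induction T with
  | nil => intro f; exact (Fintype.sum_empty (ι := Empty) _).symm
  | cons F B U ihB ihU =>
    intro f
    have h := Fintype.sum_sum_type (α₁ := Option B.InnerNode) (α₂ := U.InnerNode)
      (fun m => lin (k := k)
      (fun X => tree k ((cons F B U).attachInner (Function.update f m X)))
      (tree k (cons E C (f m)) + graftIn k E C (f m)))
    refine Eq.trans ?_ h.symm
    rw [Fintype.sum_option]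
    have e1 : ∀ X, (cons F B U).attachInner (Function.update f (Sum.inl none) X) =
        cons F (t X (B.attachInner fun n => f (Sum.inl (some n))))
          (U.attachInner fun n => f (Sum.inr n)) := by
      intro X
      simp only [attachInner]
      congr 1
    have e2 : ∀ m X, (cons F B U).attachInner (Function.update f (Sum.inl (some m)) X) =
        cons F (t (f (Sum.inl none))
          (B.attachInner (Function.update (fun n => f (Sum.inl (some n))) m X)))
          (U.attachInner fun n => f (Sum.inr n)) := by
      intro m X
      simp only [attachInner]
      congr 2
      congr 1
      funext n
      by_cases hn : n = m
      · subst hn; simp; exact Function.update_self _ _ _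
      · rw [Function.update_of_ne hn]
        exact Function.update_of_ne (fun hh => hn (Option.some.inj (Sum.inl.inj hh))) _ _
    have e3 : ∀ m X, (cons F B U).attachInner (Function.update f (Sum.inr m) X) =
        cons F (t (f (Sum.inl none)) (B.attachInner fun n => f (Sum.inl (some n))))
          (U.attachInner (Function.update (fun n => f (Sum.inr n)) m X)) := by
      intro m X
      simp only [attachInner]
      congr 2
      funext n
      by_cases hn : n = m
      · subst hn; simp; exact Function.update_self _ _ _
      · rw [Function.update_of_ne hn]
        exact Function.update_of_ne (fun hh => hn (Sum.inr.inj hh)) _ _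
    simp only [e1, e2, e3]
    simp only [attachInner, graftIn, graftIn_t, ihB, ihU, map_add, map_sum, consL, consR,
      constr_tree, lin_comp, t, Finset.sum_add_distrib]
    abel

lemma graftIn_attach (T : OTree L) (f : T.Node → OTree L) :
    tree k (cons E C (T.attach f)) + graftIn k E C (T.attach f) = ∑ m, lin (k := k)
      (fun X => tree k (T.attach (Function.update f m X)))
      (tree k (cons E C (f m)) + graftIn k E C (f m)) := by
  rw [Fintype.sum_option]
  have e1 : ∀ X, T.attach (Function.update f none X) =
      t X (T.attachInner fun n => f (some n)) := by
    intro X; simp [attach]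
  have e2 : ∀ m X, T.attach (Function.update f (some m) X) =
      t (f none) (T.attachInner (Function.update (fun n => f (some n)) m X)) := by
    intro m X
    simp only [attach]
    congr 1
    congr 1
    funext n
    by_cases hn : n = m
    · subst hn; simp
    · rw [Function.update_of_ne hn, Function.update_of_ne]
      intro hh; exact hn (Option.some.inj hh)
  simp only [e1, e2]
  simp only [attach, graftIn_t, graftIn_attachInner, map_add, map_sum, constr_tree, lin_comp, t,
    Finset.sum_add_distrib]
  abel

def fib {A T : OTree L} (d : A.Child → T.Node) (n : T.Node) : OTree L :=
  A.keep fun c => decide (d c = n)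

def mulAux (A T : OTree L) (h : T.Node → OTree L) : TreeAlg k L :=
  ∑ d : A.Child → T.Node, tree k (T.attach fun n => t (h n) (fib d n))

def consFun {F : L} {B A T : OTree L} (m : T.Node) (d : A.Child → T.Node) :
    (cons F B A).Child → T.Node := fun c => Option.rec m d c

lemma fib_consFun {F : L} {B A T : OTree L} (m : T.Node) (d : A.Child → T.Node) :
    fib (consFun (F := F) (B := B) m d) = Function.update (fib d) m (cons F B (fib d m)) := by
  funext n
  by_cases hn : n = m
  · subst hn; simp [fib, keep, consFun]; rfl
  · rw [Function.update_of_ne hn]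
    have : m ≠ n := fun h => hn h.symm
    simp [fib, keep, consFun, this]; rfl

lemma sum_cons {P : Type*} [AddCommMonoid P] {F : L} {B A T : OTree L}
    (g : ((cons F B A).Child → T.Node) → P) :
    ∑ d, g d = ∑ m : T.Node, ∑ d : A.Child → T.Node, g (consFun m d) := by
  rw [← Fintype.sum_prod_type' (f := fun m d => g (consFun m d))]
  refine (Fintype.sum_equiv (Equiv.piOptionEquivProd (α := A.Child) (β := fun _ => T.Node)) _ _
    fun d => ?_)
  congr 1
  funext c
  cases c <;> rfl

lemma mulAux_cons (F : L) (B A T : OTree L) (h : T.Node → OTree L) :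
    mulAux k (cons F B A) T h =
      ∑ m : T.Node, mulAux k A T (Function.update h m (t (h m) (u F B))) := by
  rw [mulAux, sum_cons]
  refine Finset.sum_congr rfl fun m _ => Finset.sum_congr rfl fun d _ => ?_
  congr 2
  funext n
  rw [fib_consFun]
  by_cases hn : n = m
  · subst hn; simp [t_assoc, u, t]
  · simp [Function.update_of_ne hn]

lemma mulAux_graftIn (A T : OTree L) : ∀ h : T.Node → OTree L,
    lin (k := k) (fun X => mulAux k X T h) (graftIn k E C A) =
      ∑ d : A.Child → T.Node, ∑ m : T.Node, lin (k := k)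
        (fun Y => tree k (T.attach (Function.update (fun n => t (h n) (fib d n)) m (t (h m) Y))))
        (graftIn k E C (fib d m)) := by
  induction A with
  | nil =>
    intro h
    simp [graftIn, fib, keep]
  | cons F B U _ ih =>
    intro h
    rw [sum_cons]
    rw [graftIn]
    generalize hy : tree k (cons E C B) + graftIn k E C B = y
    simp only [map_add, consL, consR, lin_comp, constr_tree, mulAux_cons, lin_sum, ih]
    rw [← Finset.sum_add_distrib]
    refine Finset.sum_congr rfl fun m0 _ => ?_
    simp only [mulAux, lin_sum]
    rw [← Finset.sum_add_distrib]
    refine Finset.sum_congr rfl fun d _ => ?_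
    rw [fib_consFun]
    set g := fib d
    set h' := Function.update h m0 (t (h m0) (u F B))
    have key : (fun n => t (h n) (Function.update g m0 (cons F B (g m0)) n)) =
        fun n => t (h' n) (g n) := by
      funext n
      by_cases hn : n = m0
      · subst hn; simp [h', t_assoc, u, t]
      · simp [h', Function.update_of_ne hn]
    rw [key]
    have key2 : ∀ B', (fun n => t (Function.update h m0 (t (h m0) (u F B')) n) (g n)) =
        Function.update (fun n => t (h' n) (g n)) m0 (t (h m0) (cons F B' (g m0))) := by
      intro B'
      funext n
      by_cases hn : n = m0
      · subst hn; simp [t_assoc, u, t]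
      · simp [h', Function.update_of_ne hn]
    simp only [key2]
    set w := fun n => t (h' n) (g n)
    have key3 : ∀ m, lin (k := k) (fun Y => tree k (T.attach (Function.update w m (t (h m) Y))))
        (graftIn k E C (Function.update g m0 (cons F B (g m0)) m)) =
        lin (k := k) (fun Y => tree k (T.attach (Function.update w m (t (h' m) Y))))
          (graftIn k E C (g m)) +
        if m = m0 then lin (k := k) (fun B' => tree k (T.attach
          (Function.update w m0 (t (h m0) (cons F B' (g m0))))))
          y else 0 := by
      intro m
      by_cases hm : m = m0
      · subst hm
        simp only [Function.update_self, graftIn, hy, map_add, consL, consR, lin_comp, constr_tree,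
          if_true, h', t_assoc, u, t]
        abel
      · simp [h', hm]
    simp only [key3, Finset.sum_add_distrib, Finset.sum_ite_eq', Finset.mem_univ, if_true]
    abel

lemma treeMul_eq_mulAux (A T : OTree L) :
    treeMul k L (tree k A) (tree k T) = mulAux k A T fun _ => nil := by
  rw [treeMul_tree]; rfl

def graft : TreeAlg k L →ₗ[k] TreeAlg k L :=
  lin (k := k) fun X => tree k (cons E C X) + graftIn k E C X

lemma treeMul_cons (A T : OTree L) :
    treeMul k L (tree k (cons E C A)) (tree k T) =
      graft k E C (treeMul k L (tree k A) (tree k T)) -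
        treeMul k L (graftIn k E C A) (tree k T) := by
  rw [eq_sub_iff_add_eq]
  have h1 : treeMul k L (graftIn k E C A) (tree k T) =
      lin (k := k) (fun X => mulAux k X T fun _ => nil) (graftIn k E C A) := by
    have : (treeMul k L).flip (tree k T) = lin (k := k) (fun X => mulAux k X T fun _ => nil) :=
      (treeBasis k L).ext fun X => by
        rw [treeBasis_apply, LinearMap.flip_apply, treeMul_eq_mulAux, constr_tree]
    exact congrArg (fun f => f (graftIn k E C A)) this
  rw [h1, mulAux_graftIn, treeMul_tree, treeMul_tree, sum_cons, Finset.sum_comm, map_sum,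
    ← Finset.sum_add_distrib]
  refine Finset.sum_congr rfl fun d _ => ?_
  rw [graft, constr_tree]
  have : A.link T d = T.attach (fib d) := rfl
  rw [this, graftIn_attach, ← Finset.sum_add_distrib]
  refine Finset.sum_congr rfl fun m _ => ?_
  have e : (cons E C A).link T (consFun m d) =
      T.attach (Function.update (fib d) m (cons E C (fib d m))) := by
    rw [← fib_consFun]; rfl
  rw [e, map_add, constr_tree]
  rfl

lemma treeMul_u (X : TreeAlg k L) : treeMul k L (tree k (u E C)) X = graft k E C X := by
  suffices treeMul k L (tree k (u E C)) = graft k E C by rw [this]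
  refine (treeBasis k L).ext fun T => ?_
  rw [treeBasis_apply, u, treeMul_cons, one_mul']
  simp [graftIn]

end graft

def size : OTree L → ℕ
  | nil => 0
  | cons _ _ U => size U + 1

lemma graftIn_mem_span (E : L) (C A : OTree L) :
    graftIn k E C A ∈ Submodule.span k {x | ∃ B : OTree L, size B = size A ∧ x = tree k B} := by
  induction A with
  | nil => exact Submodule.zero_mem _
  | cons F B U _ ih =>
    rw [graftIn]
    refine Submodule.add_mem _ ?_ ?_
    · generalize tree k (cons E C B) + graftIn k E C B = y
      have : (⊤ : Submodule k (TreeAlg k L)) ≤ (Submodule.span k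
          {x | ∃ B' : OTree L, size B' = size (cons F B U) ∧ x = tree k B'}).comap
            (consL k F U) := by
        rw [← (treeBasis k L).span_eq, Submodule.span_le]
        rintro _ ⟨X, rfl⟩
        refine Submodule.subset_span ⟨cons F X U, rfl, ?_⟩
        simp [consL]
      exact this trivial
    · have : Submodule.span k {x | ∃ B' : OTree L, size B' = size U ∧ x = tree k B'} ≤
          (Submodule.span k
          {x | ∃ B' : OTree L, size B' = size (cons F B U) ∧ x = tree k B'}).comap
            (consR k F B) := by
        rw [Submodule.span_le]
        rintro _ ⟨X, hX, rfl⟩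
        refine Submodule.subset_span ⟨cons F B X, by simp [size, hX], ?_⟩
        simp [consR]
      exact this ih

lemma tree_induction (P : Submodule k (TreeAlg k L)) (h0 : tree k nil ∈ P)
    (hs : ∀ (E : L) (C U : OTree L), tree k U ∈ P → graftIn k E C U ∈ P →
      tree k (cons E C U) ∈ P) (x : TreeAlg k L) : x ∈ P := by
  have key : ∀ n, ∀ A : OTree L, size A = n → tree k A ∈ P := by
    intro n
    induction n with
    | zero =>
      intro A hA
      cases A with
      | nil => exact h0
      | cons E C U => simp [size] at hA
    | succ n ih =>
      intro A hA
      cases A with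
      | nil => exact h0
      | cons E C U =>
        have hU : size U = n := by simpa [size] using hA
        refine hs E C U (ih U hU) ?_
        refine (Submodule.span_le.2 ?_) (graftIn_mem_span k E C U)
        rintro _ ⟨B, hB, rfl⟩
        exact ih B (hB.trans hU)
  have : (⊤ : Submodule k (TreeAlg k L)) ≤ P := by
    rw [← (treeBasis k L).span_eq, Submodule.span_le]
    rintro _ ⟨X, rfl⟩
    exact key _ X rfl
  exact this trivial

lemma treeMul_cons' (E : L) (C A : OTree L) (x : TreeAlg k L) :
    treeMul k L (tree k (cons E C A)) x =
      graft k E C (treeMul k L (tree k A) x) - treeMul k L (graftIn k E C A) x := by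
  suffices treeMul k L (tree k (cons E C A)) =
      graft k E C ∘ₗ treeMul k L (tree k A) - treeMul k L (graftIn k E C A) by rw [this]; rfl
  refine (treeBasis k L).ext fun T => ?_
  rw [treeBasis_apply, treeMul_cons]; rfl

lemma treeMul_graft (E : L) (C : OTree L) (x y : TreeAlg k L) :
    treeMul k L (graft k E C x) y = graft k E C (treeMul k L x y) := by
  suffices treeMul k L ∘ₗ graft k E C = (treeMul k L).compr₂ (graft k E C) from
    congrArg (fun f => f x y) this
  refine (treeBasis k L).ext fun A => ?_
  ext y
  simp only [LinearMap.comp_apply, treeBasis_apply, LinearMap.compr₂_apply]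
  rw [graft, constr_tree, map_add, LinearMap.add_apply, treeMul_cons']
  simp [graft]

lemma treeMul_assoc (x y z : TreeAlg k L) :
    treeMul k L (treeMul k L x y) z = treeMul k L x (treeMul k L y z) := by
  let P : Submodule k (TreeAlg k L) :=
    { carrier := {x | ∀ y z, treeMul k L (treeMul k L x y) z = treeMul k L x (treeMul k L y z)}
      add_mem' := fun ha hb y z => by simp [ha y z, hb y z]
      zero_mem' := fun y z => by simp
      smul_mem' := fun c a ha y z => by simp [ha y z] }
  refine tree_induction k P ?_ ?_ x y z
  · intro y z; simp [one_mul']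
  · intro E C U hU hg y z
    rw [treeMul_cons', treeMul_cons', map_sub, LinearMap.sub_apply, treeMul_graft, hU y z,
      hg y z]

end TreeProof

/-- The tree with one node is the unit. -/
instance : One (TreeAlg k L) := ⟨tree k OTree.nil⟩
instance : Mul (TreeAlg k L) := ⟨fun x y => treeMul k L x y⟩

instance : Ring (TreeAlg k L) where
  left_distrib x y z := map_add (treeMul k L x) y z
  right_distrib x y z := by
    change treeMul k L (x + y) z = treeMul k L x z + treeMul k L y z
    rw [map_add, LinearMap.add_apply]
  zero_mul x := by change treeMul k L 0 x = 0; rw [map_zero, LinearMap.zero_apply]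
  mul_zero x := map_zero (treeMul k L x)
  mul_assoc := TreeProof.treeMul_assoc k
  one_mul := TreeProof.one_mul' k
  mul_one := TreeProof.mul_one' k
  neg_add_cancel := neg_add_cancel
  zsmul := fun n x => n • x
  zsmul_zero' := SubNegMonoid.zsmul_zero'
  zsmul_succ' := SubNegMonoid.zsmul_succ'
  zsmul_neg' := SubNegMonoid.zsmul_neg'
  sub_eq_add_neg := sub_eq_add_neg

instance : Algebra k (TreeAlg k L) :=
  Algebra.ofModule
    (fun r x y => by
      change treeMul k L (r • x) y = r • treeMul k L x y
      rw [map_smul, LinearMap.smul_apply])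
    (fun r x y => map_smul (treeMul k L x) r y)


/-- The coproduct of a tree is the sum over all ways to distribute the children of the root (with
their branches) over two trees; the counit is `1` on the one-node tree, `0` on other trees. -/
instance : CoalgebraStruct k (TreeAlg k L) where
  comul := (treeBasis k L).constr k fun T =>
    ∑ q : T.Child → Bool, tree k (T.keep q) ⊗ₜ[k] tree k (T.keep fun c => !q c)
  counit := (treeBasis k L).constr k fun T =>
    match T with
    | .nil => 1
    | .cons _ _ _ => 0

/-- The coproduct on a free algebra for which the generators are primitive. -/
instance freeCoalgebraStruct (X : Type*) : CoalgebraStruct k (FreeAlgebra k X) where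
  comul := (FreeAlgebra.lift k fun x =>
    FreeAlgebra.ι k x ⊗ₜ[k] 1 + 1 ⊗ₜ[k] FreeAlgebra.ι k x).toLinearMap
  counit := (FreeAlgebra.lift k fun _ => (0 : k)).toLinearMap

section uea
variable (𝔤 : Type*) [LieRing 𝔤] [LieAlgebra k 𝔤]

attribute [local instance] LieRing.ofAssociativeRing

/-- The coproduct of an enveloping algebra: elements of the Lie algebra are primitive. -/
def ueaComul : UniversalEnvelopingAlgebra k 𝔤 →ₐ[k]
    UniversalEnvelopingAlgebra k 𝔤 ⊗[k] UniversalEnvelopingAlgebra k 𝔤 :=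
  UniversalEnvelopingAlgebra.lift k
    { toFun := fun x => UniversalEnvelopingAlgebra.ι k x ⊗ₜ[k] 1 +
        1 ⊗ₜ[k] UniversalEnvelopingAlgebra.ι k x
      map_add' := fun x y => by
        simp only [map_add, TensorProduct.add_tmul, TensorProduct.tmul_add]; abel
      map_smul' := fun c x => by
        simp only [map_smul, TensorProduct.smul_tmul', TensorProduct.tmul_smul, smul_add,
          RingHom.id_apply]
      map_lie' := fun {x y} => by
        simp only [LieHom.map_lie, LieRing.of_associative_ring_bracket, add_mul, mul_add,
          Algebra.TensorProduct.tmul_mul_tmul, TensorProduct.sub_tmul, TensorProduct.tmul_sub,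
          one_mul, mul_one]
        abel }

instance ueaCoalgebraStruct : CoalgebraStruct k (UniversalEnvelopingAlgebra k 𝔤) where
  comul := (ueaComul k 𝔤).toLinearMap
  counit := (UniversalEnvelopingAlgebra.lift k (0 : 𝔤 →ₗ⁅k⁆ k)).toLinearMap

end uea
section der
variable (R : Type*) [CommRing R] [Algebra k R]

/-- The Lie algebra of `k`-derivations of `R`. -/
abbrev Der := Derivation k R R
/-- Its enveloping algebra over `k`. -/
abbrev UDer := UniversalEnvelopingAlgebra k (Der k R)

attribute [local instance] LieRing.ofAssociativeRing
/-- Derivations as `k`-linear endomorphisms. -/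
def derEnd : Der k R →ₗ⁅k⁆ Module.End k R where
  toFun E := E.toLinearMap
  map_add' _ _ := rfl
  map_smul' _ _ := rfl
  map_lie' := by
    intro E F
    ext r
    simp [LieRing.of_associative_ring_bracket]

/-- The action of the enveloping algebra on `R`. -/
def ueaAct : UDer k R →ₐ[k] Module.End k R :=
  UniversalEnvelopingAlgebra.lift k (derEnd k R)


variable {R}

/-- The subalgebra of the enveloping algebra of `Der k R` generated by `S`. -/
def Diff (S : Set (Der k R)) : Subalgebra k (UDer k R) :=
  Algebra.adjoin k (UniversalEnvelopingAlgebra.ι k '' S)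

/-- The inclusion of the tensor square of `Diff k S` into that of the enveloping algebra; it is
injective as `k` is a field. -/
def diffPair (S : Set (Der k R)) : Diff k S ⊗[k] Diff k S →ₐ[k] UDer k R ⊗[k] UDer k R :=
  Algebra.TensorProduct.map (Diff k S).val (Diff k S).val

lemma diffPair_injective (S : Set (Der k R)) : Function.Injective (diffPair k S) :=
  TensorProduct.map_injective_of_flat_flat (Diff k S).val.toLinearMap (Diff k S).val.toLinearMap
    Subtype.val_injective Subtype.val_injective

lemma ueaComul_mem (S : Set (Der k R)) (x : Diff k S) :
    ueaComul k (Der k R) x ∈ (diffPair k S).range := by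
  suffices Diff k S ≤ (diffPair k S).range.comap (ueaComul k (Der k R)) from this x.2
  refine Algebra.adjoin_le ?_
  rintro _ ⟨E, hE, rfl⟩
  refine ⟨(⟨_, Algebra.subset_adjoin ⟨E, hE, rfl⟩⟩ : Diff k S) ⊗ₜ 1 +
    1 ⊗ₜ (⟨_, Algebra.subset_adjoin ⟨E, hE, rfl⟩⟩ : Diff k S), ?_⟩
  simp only [ueaComul, diffPair]
  erw [UniversalEnvelopingAlgebra.lift_ι_apply]
  simp

/-- The coproduct of the enveloping algebra, restricted to `Diff k S`. -/
def diffComul (S : Set (Der k R)) : Diff k S →ₐ[k] Diff k S ⊗[k] Diff k S :=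
  (AlgEquiv.ofInjective (diffPair k S) (diffPair_injective k S)).symm.toAlgHom.comp
    (((ueaComul k (Der k R)).comp (Diff k S).val).codRestrict _ (ueaComul_mem k S))

instance (S : Set (Der k R)) : CoalgebraStruct k (Diff k S) where
  comul := (diffComul k S).toLinearMap
  counit := CoalgebraStruct.counit ∘ₗ (Diff k S).val.toLinearMap

variable (R) in
/-- Connections on the Lie algebra of derivations of `R`. -/
structure Connection where
  /-- `conn E F` is the derivative of `F` along `E`. -/
  conn : Der k R → Der k R → Der k R
  conn_add_left : ∀ E₁ E₂ F, conn (E₁ + E₂) F = conn E₁ F + conn E₂ F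
  conn_add_right : ∀ E F₁ F₂, conn E (F₁ + F₂) = conn E F₁ + conn E F₂
  conn_smul_left : ∀ (f : R) E F, conn (f • E) F = f • conn E F
  conn_smul_right : ∀ (f : R) E F, conn E (f • F) = f • conn E F + E f • F

variable {k}

/-- Iterated covariant derivative along a list of derivations:
`D(F₁,…,Fₙ) = A F₁ (D(F₂,…,Fₙ)) - ∑ᵢ D(F₂,…,∇_{F₁} Fᵢ,…,Fₙ)`, with value `m` on the empty list.
This is the recursion obtained by solving the product formula of the tree `v(F₁)` with
`u(E; v(F₂),…,v(Fₙ))` (for `A = ∇`), or with `t(v(F₂),…,v(Fₙ))` (for `A` multiplication by `F₁`),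
for the tree in which `F₁` becomes a further first sibling of `F₂,…,Fₙ`. -/
def covIter {M : Type*} [AddCommGroup M] (nab : Connection k R) (A : Der k R → M → M) (m : M) :
    List (Der k R) → M
  | [] => m
  | F :: l => A F (covIter nab A m l) -
      ∑ i : Fin l.length, covIter nab A m (l.set i (nab.conn F (l.get i)))
  termination_by l => l.length

/-- The derivations as which the branches at the root act, in order: a branch `u(E; T₁,…,Tₙ)`,
whose sub-branches act as `F₁,…,Fₙ`, acts as `u(E; v(F₁),…,v(Fₙ))`. -/
def branchDer (nab : Connection k R) : OTree (Der k R) → List (Der k R)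
  | .nil => []
  | .cons E C V => covIter nab nab.conn E (branchDer nab C) :: branchDer nab V

/-- The map from trees to the enveloping algebra given by the connection. -/
def treeToU (nab : Connection k R) : TreeAlg k (Der k R) →ₗ[k] UDer k R :=
  (treeBasis k _).constr k fun T =>
    covIter nab (fun F x => UniversalEnvelopingAlgebra.ι k F * x) 1 (branchDer nab T)

/-- The action of trees on `R` given by the connection. -/
def treeAct (nab : Connection k R) : TreeAlg k (Der k R) →ₗ[k] Module.End k R :=
  (ueaAct k R).toLinearMap ∘ₗ treeToU nab

/-- `Replace E C G T T'`: the tree `T'` results from `T` by replacing, somewhere in `T`, one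
branch `u(E; C)` by the branch `v(G)`. -/
inductive Replace {L : Type*} (E : L) (C : OTree L) (G : L) : OTree L → OTree L → Prop
  | here (V : OTree L) : Replace E C G (.cons E C V) (.cons G .nil V)
  | child (F : L) (V : OTree L) {B B' : OTree L} :
      Replace E C G B B' → Replace E C G (.cons F B V) (.cons F B' V)
  | sibling (F : L) (B : OTree L) {V V' : OTree L} :
      Replace E C G V V' → Replace E C G (.cons F B V) (.cons F B V')

/-- What it means that an action of the algebra of trees on `R` is the one built from the connection:
it is a module structure, `v(E)` acts as `E`, `u(E; v(F))` acts as `∇_F E`, and a branch which acts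
as a derivation `G` may be replaced by `v(G)` inside any tree. -/
structure IsConnAction (nab : Connection k R) (ψ : TreeAlg k (Der k R) →ₗ[k] Module.End k R) :
    Prop where
  map_one : ψ 1 = 1
  map_mul : ∀ x y, ψ (x * y) = ψ x * ψ y
  act_v : ∀ E : Der k R, ψ (tree k (OTree.v E)) = E.toLinearMap
  act_u : ∀ E F : Der k R, ψ (tree k (OTree.u E (OTree.v F))) = (nab.conn F E).toLinearMap
  coherent : ∀ (E : Der k R) (C : OTree (Der k R)) (G : Der k R),
    ψ (tree k (OTree.u E C)) = G.toLinearMap →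
      ∀ T T' : OTree (Der k R), Replace E C G T T' → ψ (tree k T) = ψ (tree k T')

/-- The elements of `S` as labels among all derivations. -/
def treeIncl (S : Set (Der k R)) : TreeAlg k S →ₗ[k] TreeAlg k (Der k R) :=
  (treeBasis k _).constr k fun T => tree k (T.map Subtype.val)

/-- The map from trees labelled by `S` to the enveloping algebra given by the connection. -/
def treeToUOn (nab : Connection k R) (S : Set (Der k R)) : TreeAlg k S →ₗ[k] UDer k R :=
  treeToU nab ∘ₗ treeIncl S

/-- The same map with values in `Diff k S`, when its values lie there. -/
def treeToDiff (nab : Connection k R) (S : Set (Der k R))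
    (h : ∀ x, treeToUOn nab S x ∈ Diff k S) : TreeAlg k S →ₗ[k] Diff k S where
  toFun x := ⟨treeToUOn nab S x, h x⟩
  map_add' x y := Subtype.ext (map_add (treeToUOn nab S) x y)
  map_smul' c x := Subtype.ext (map_smul (treeToUOn nab S) c x)

/-- The algebra map from the free algebra on `S` which sends `E` to the two-node tree `v(E)`. -/
def freeToTree (S : Set (Der k R)) : FreeAlgebra k S →ₐ[k] TreeAlg k S :=
  FreeAlgebra.lift k fun E => tree k (OTree.v E)

/-- The algebra map from the free algebra on `S` which sends `E` to `E`. -/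
def freeToDiff (S : Set (Der k R)) : FreeAlgebra k S →ₐ[k] Diff k S :=
  FreeAlgebra.lift k fun E =>
    ⟨UniversalEnvelopingAlgebra.ι k E.1, Algebra.subset_adjoin ⟨E.1, E.2, rfl⟩⟩

/-- The action of the free algebra on `R`: generators act as the derivations which they are. -/
def freeAct (S : Set (Der k R)) : FreeAlgebra k S →ₗ[k] Module.End k R :=
  (FreeAlgebra.lift k fun E : S => (E.1.toLinearMap : Module.End k R)).toLinearMap

/-- The action on `R` of trees labelled by `S`. -/
def treeActOn (nab : Connection k R) (S : Set (Der k R)) :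
    TreeAlg k S →ₗ[k] Module.End k R :=
  treeAct nab ∘ₗ treeIncl S

/-- The action of `Diff k S` on `R`. -/
def diffAct (S : Set (Der k R)) : Diff k S →ₗ[k] Module.End k R :=
  ((ueaAct k R).comp (Diff k S).val).toLinearMap

end der

section smash

variable (R H : Type*) [CommRing R] [Algebra k R] [Ring H] [Algebra k H]
variable (H' : Type*) [Ring H'] [Algebra k H']

/-- The space underlying the smash product of `R` and `H`. Its product depends on the action of `H`
on `R` and is `smashMul`; it is not the usual product of the tensor product of algebras. -/
def Smash := R ⊗[k] H

instance : AddCommGroup (Smash k R H) := inferInstanceAs (AddCommGroup (R ⊗[k] H))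
instance : Module R (Smash k R H) := inferInstanceAs (Module R (R ⊗[k] H))
instance : Module k (Smash k R H) := inferInstanceAs (Module k (R ⊗[k] H))

/-- The coproduct over `R`, induced by that of `H`. -/
instance [CoalgebraStruct k H] : CoalgebraStruct R (Smash k R H) :=
  inferInstanceAs (CoalgebraStruct R (R ⊗[k] H))

variable {R H H'}

/-- The element `r ⋊ h`. -/
def smash (r : R) (h : H) : Smash k R H := (r ⊗ₜ[k] h : R ⊗[k] H)

variable {k}

/-- The product of the smash product, on the tensor product; see `smashMul_smash`. -/
def smashMulAux [CoalgebraStruct k H] (act : H →ₗ[k] Module.End k R) :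
    R ⊗[k] H →ₗ[k] R ⊗[k] H →ₗ[k] R ⊗[k] H :=
  TensorProduct.homTensorHomMap (RingHom.id k) R H R H ∘ₗ
    TensorProduct.map
      (LinearMap.mul' k (Module.End k R) ∘ₗ
        TensorProduct.map (Algebra.lmul k R).toLinearMap act)
      (Algebra.lmul k H).toLinearMap ∘ₗ
    (TensorProduct.assoc k R H H).symm.toLinearMap ∘ₗ
    TensorProduct.map LinearMap.id CoalgebraStruct.comul

/-- The product of the smash product: `(r ⋊ h)(s ⋊ g) = ∑ r (h₁ · s) ⋊ h₂ g`. -/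
def smashMul [CoalgebraStruct k H] (act : H →ₗ[k] Module.End k R) :
    Smash k R H →ₗ[k] Smash k R H →ₗ[k] Smash k R H :=
  smashMulAux act

/-- The formula for the product, for any representation of the coproduct of `h`. -/
lemma smashMul_smash [CoalgebraStruct k H] (act : H →ₗ[k] Module.End k R)
    {ι : Type*} (I : Finset ι) (h : H) (a b : ι → H)
    (hab : CoalgebraStruct.comul (R := k) h = ∑ j ∈ I, a j ⊗ₜ[k] b j) (r s : R) (g : H) :
    smashMul act (smash k r h) (smash k s g) =
      ∑ j ∈ I, smash k (r * act (a j) s) (b j * g) := by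
  have key : smashMulAux act (r ⊗ₜ[k] h) (s ⊗ₜ[k] g) =
      ∑ j ∈ I, (r * act (a j) s) ⊗ₜ[k] (b j * g) := by
    simp only [smashMulAux, LinearMap.comp_apply, TensorProduct.map_tmul, hab,
      TensorProduct.tmul_sum, map_sum, LinearMap.sum_apply]
    simp
  exact key

/-- The map `r ⋊ h ↦ r ⋊ f h`. -/
def smashMap (f : H →ₗ[k] H') : Smash k R H →ₗ[R] Smash k R H' :=
  f.baseChange R

/-- Homomorphisms of `R/k`-bialgebras between smash products: `R`-linear maps which respect unit,
product, coproduct and counit. -/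
structure IsRkHom [CoalgebraStruct k H] [CoalgebraStruct k H']
    (act : H →ₗ[k] Module.End k R) (act' : H' →ₗ[k] Module.End k R)
    (f : Smash k R H →ₗ[R] Smash k R H') : Prop where
  map_one : f (smash k 1 1) = smash k 1 1
  map_mul : ∀ x y, f (smashMul act x y) = smashMul act' (f x) (f y)
  map_comul : ∀ x, TensorProduct.map f f (CoalgebraStruct.comul x) = CoalgebraStruct.comul (f x)
  map_counit : ∀ x, CoalgebraStruct.counit (R := R) (f x) = CoalgebraStruct.counit (R := R) x

end smash

section triangle

variable {k} {R : Type*} [CommRing R] [Algebra k R]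

/-- The map `i`, induced by `E ↦ v(E)`. -/
def iMap (S : Set (Der k R)) : Smash k R (FreeAlgebra k S) →ₗ[R] Smash k R (TreeAlg k S) :=
  smashMap (freeToTree S).toLinearMap

/-- The map `p`, induced by `E ↦ E`. -/
def pMap (S : Set (Der k R)) : Smash k R (FreeAlgebra k S) →ₗ[R] Smash k R (Diff k S) :=
  smashMap (freeToDiff S).toLinearMap

/-- The inclusion of the smash product with `Diff k S` into that with the enveloping algebra. -/
def inclMap (S : Set (Der k R)) : Smash k R (Diff k S) →ₗ[R] Smash k R (UDer k R) :=
  smashMap (Diff k S).val.toLinearMap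

/-- The map `φ` induced by the connection, with values in the smash product with the enveloping
algebra. -/
def phiMap (nab : Connection k R) (S : Set (Der k R)) :
    Smash k R (TreeAlg k S) →ₗ[R] Smash k R (UDer k R) :=
  smashMap (treeToUOn nab S)

/-- The map `φ` with values in the smash product with `Diff k S`. -/
def phiDiff (nab : Connection k R) (S : Set (Der k R))
    (h : ∀ x, treeToUOn nab S x ∈ Diff k S) :
    Smash k R (TreeAlg k S) →ₗ[R] Smash k R (Diff k S) :=
  smashMap (treeToDiff nab S h)

end triangle

end ConnTree

end

/-! Left multiplication by a one-branch tree u(E; C) is the operator `graft`: it links the branch to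
the root in first place, or to any other node. The second kind of term, `graftIn`, does not change
the number of branches at the root. Since cons E C U equals u(E; C) · U minus the `graftIn` terms,
induction on that number shows that the trees u(E; C) generate the algebra. Two tools result: a
linear map f with f(1) = 1 and f(`graft` x) = a(E, C) f(x) is multiplicative (`map_mul_of_graft`),
and two algebra maps which agree on all u(E; C) are equal (`treeAlgHom_ext`).

For Ψ the point is that, at the level of the derivations of the branches, linking u(E; C) to the
inner nodes applies ∇_G to one branch derivation at a time, G being the derivation of u(E; C)
(`graftsAsDerivative`). These are exactly the terms subtracted in the recursion for W, so they
cancel and Ψ(u(E; C) · T) = G Ψ(T) (`treeToU_graft`). The same cancellation, in the recursion for D,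
proves the statement inside each branch.

Uniqueness runs the recursions backwards. In any admissible action, the product of v(F) with a tree
whose branches are leaves, or with u(E; such a tree), can be solved for the tree with one more leaf.
This forces u(E; v(F₁),…,v(Fₙ)) to act as Dₙ (`IsConnAction.act_u_flat`), whence coherence reduces
every tree to one whose branches are leaves, and on those the action is determined too
(`IsConnAction.eq_on_flat`).

The coproduct turns `graft` into multiplication by a primitive element (`comul_graft`), so it is an
algebra map, and compatibility of Ψ with coproducts need only be checked on the u(E; C), which Ψ
sends to derivations. Bialgebra maps which respect the actions on R pass to smash products
(`isRkHom_smashMap`), and the triangle commutes because Ψ(v(E)) = E. -/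

namespace ConnTree

open TreeProof

/-! ### Differentiating the entries of a list one at a time. -/

section Lists

variable {k : Type*} [Field k] {V M N : Type*} [AddCommGroup V] [Module k V]
  [AddCommGroup M] [Module k M] [AddCommGroup N] [Module k N]

/-- The sum of the values of `Φ` at the lists obtained from `l` by applying `δ` to one entry. -/
def setSum {α M : Type*} [AddCommGroup M] (Φ : List α → M) (δ : α → α) : List α → M
  | [] => 0
  | x :: l => Φ (δ x :: l) + setSum (fun l' => Φ (x :: l')) δ l

/-- Links the sum over positions in `covIter` to the form by recursion on the list, which matches
the recursion of `graftIn` over the branches at the root. -/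
lemma setSum_eq_sum {α M : Type*} [AddCommGroup M] (δ : α → α) (l : List α) :
    ∀ Φ : List α → M, setSum Φ δ l = ∑ i : Fin l.length, Φ (l.set i (δ (l.get i))) := by
  induction l with
  | nil => intro Φ; rfl
  | cons x l ih =>
    intro Φ
    rw [setSum, ih]
    exact (Fin.sum_univ_succ
      (fun i : Fin (l.length + 1) => Φ ((x :: l).set i (δ ((x :: l).get i))))).symm

/-- Changing an entry keeps the length, so agreement in that one length is enough. This is what lets
the inductions on length below apply their hypothesis inside the sum. -/
lemma setSum_congr {α M : Type*} [AddCommGroup M] (δ : α → α) (l : List α) :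
    ∀ Φ Φ' : List α → M, (∀ l', l'.length = l.length → Φ l' = Φ' l') →
      setSum Φ δ l = setSum Φ' δ l := by
  induction l with
  | nil => intro Φ Φ' _; rfl
  | cons x l ih =>
    intro Φ Φ' h
    rw [setSum, setSum, h (δ x :: l) rfl, ih _ _ fun l' hl' => h _ (by simp [hl'])]

lemma setSum_isLinearMap {α : Type*} (f : V → List α → M) (δ : α → α) (l : List α)
    (hf : ∀ l', l'.length = l.length → IsLinearMap k fun x => f x l') :
    IsLinearMap k fun x => setSum (f x) δ l := by
  induction l generalizing f with
  | nil => exact ⟨fun _ _ => (add_zero _).symm, fun c _ => (smul_zero c).symm⟩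
  | cons a l ih =>
    have h1 := hf (δ a :: l) rfl
    have h2 := ih (fun x l' => f x (a :: l')) fun l' hl' => hf (a :: l') (by simp [hl'])
    exact (h1.mk' _ + h2.mk' _).isLinear

lemma map_setSum {α : Type*} (g : M →ₗ[k] N) (δ : α → α) (l : List α) :
    ∀ Φ : List α → M, g (setSum Φ δ l) = setSum (fun l' => g (Φ l')) δ l := by
  induction l with
  | nil => intro Φ; exact map_zero g
  | cons x l ih => intro Φ; rw [setSum, map_add, ih]; rfl

variable (k) in
/-- Linearity of `Φ` in every entry of a list of length `n`. -/
def EntryLinear (n : ℕ) (Φ : List V → M) : Prop :=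
  ∀ l₁ l₂ : List V, l₁.length + l₂.length + 1 = n → IsLinearMap k fun x => Φ (l₁ ++ x :: l₂)

lemma EntryLinear.cons {n : ℕ} {Φ : List V → M} (h : EntryLinear k (n + 1) Φ) (x : V) :
    EntryLinear k n fun l => Φ (x :: l) := fun l₁ l₂ hl =>
  h (x :: l₁) l₂ (by simp only [List.length_cons]; omega)

lemma EntryLinear.setSum {n : ℕ} {Φ : List V → M} (h : EntryLinear k n Φ) (δ : V →ₗ[k] V) :
    EntryLinear k n (setSum Φ δ) := by
  intro l₁ l₂ hl
  induction l₁ generalizing Φ n with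
  | nil =>
    have h1 : IsLinearMap k fun x => Φ (δ x :: l₂) := ((h [] l₂ hl).mk' _ ∘ₗ δ).isLinear
    have h2 := setSum_isLinearMap (fun x l' => Φ (x :: l')) δ l₂ fun l' hl' =>
      h [] l' (by rw [hl']; exact hl)
    simp only [List.nil_append, ConnTree.setSum]
    exact (h1.mk' _ + h2.mk' _).isLinear
  | cons a l₁ ih =>
    simp only [List.length_cons] at hl
    obtain ⟨m, rfl⟩ : ∃ m, n = m + 1 := ⟨n - 1, by omega⟩
    have h1 := h (δ a :: l₁) l₂ (by simp only [List.length_cons]; omega)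
    have h2 := ih (h.cons a) (by omega)
    exact (h1.mk' _ + h2.mk' _).isLinear

lemma EntryLinear.setSum_right {Φ : List V → M} {l : List V} (h : EntryLinear k l.length Φ)
    {δ : V → V → V} (hδ : ∀ y, IsLinearMap k fun x => δ x y) :
    IsLinearMap k fun x => ConnTree.setSum Φ (δ x) l := by
  induction l generalizing Φ with
  | nil => exact ⟨fun _ _ => (add_zero _).symm, fun c _ => (smul_zero c).symm⟩
  | cons a l ih =>
    have h1 : IsLinearMap k fun x => Φ (δ x a :: l) :=
      ((h [] l (by simp)).mk' _ ∘ₗ (hδ a).mk' _).isLinear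
    have h2 := ih (h.cons a)
    simp only [ConnTree.setSum]
    exact (h1.mk' _ + h2.mk' _).isLinear

end Lists

/-! ### Grafting onto inner nodes as covariant differentiation. -/

section Covariant

variable {k : Type*} [Field k] {R : Type*} [CommRing R] [Algebra k R] (nab : Connection k R)

lemma Connection.isLinearMap_left (F : Der k R) : IsLinearMap k fun E => nab.conn E F where
  map_add x y := nab.conn_add_left x y F
  map_smul c x := by
    rw [← algebraMap_smul R c x, nab.conn_smul_left, algebraMap_smul]

lemma Connection.isLinearMap_right (E : Der k R) : IsLinearMap k (nab.conn E) where
  map_add x y := nab.conn_add_right E x y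
  map_smul c x := by
    -- Derivations kill constants, so the Leibniz term vanishes for scalars from k.
    rw [← algebraMap_smul R c x, nab.conn_smul_right, Derivation.map_algebraMap, zero_smul,
      add_zero, algebraMap_smul]

lemma covIter_nil {M : Type*} [AddCommGroup M] (nab : Connection k R)
    (A : Der k R → M → M) (m : M) : covIter nab A m [] = m := by
  rw [covIter]

lemma covIter_cons {M : Type*} [AddCommGroup M] (nab : Connection k R) (A : Der k R → M → M) (m : M) (F : Der k R) (l : List (Der k R)) :
    covIter nab A m (F :: l) =
      A F (covIter nab A m l) - setSum (covIter nab A m) (nab.conn F) l := by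
  rw [covIter, setSum_eq_sum]

variable {M : Type*} [AddCommGroup M] [Module k M]

/-- By induction on the length: the first entry enters through `A` and through the lower slot of ∇,
the later ones through shorter lists and the differentiated slot of ∇. In that slot ∇ is linear over
k only, so R-linearity is not available. -/
lemma covIter_entryLinear {A : Der k R → M → M} (hA₁ : ∀ x, IsLinearMap k fun F => A F x)
    (hA₂ : ∀ F, IsLinearMap k (A F)) (m : M) (n : ℕ) :
    EntryLinear k n (covIter nab A m) := by
  induction n with
  | zero => intro l₁ l₂ hl; omega
  | succ n ih =>
    intro l₁ l₂ hl
    cases l₁ with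
    | nil =>
      have hn : l₂.length = n := by simpa using hl
      subst hn
      simp only [List.nil_append, covIter_cons]
      exact ((hA₁ (covIter nab A m l₂)).mk' _ -
        (ih.setSum_right nab.isLinearMap_left).mk' _).isLinear
    | cons a l₁ =>
      have hn : l₁.length + l₂.length + 1 = n := by simp at hl; omega
      simp only [List.cons_append, covIter_cons]
      exact ((hA₂ a).mk' _ ∘ₗ (ih l₁ l₂ hn).mk' _ -
        (ih.setSum ((nab.isLinearMap_right a).mk' _) l₁ l₂ hn).mk' _).isLinear

/-- The derivation of the branch `u(E; C)`. -/
def topDer (E : Der k R) (C : OTree (Der k R)) : Der k R :=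
  covIter nab nab.conn E (branchDer nab C)

/-- Grafting the branch `u(E; C)` onto the inner nodes of a tree differentiates, one after the
other, the derivations of its branches. -/
def GraftsAsDerivative (E : Der k R) (C : OTree (Der k R)) (Φ : List (Der k R) → M)
    (X : OTree (Der k R)) : Prop :=
  lin (k := k) (fun T => Φ (branchDer nab T)) (graftIn k E C X) =
    setSum Φ (nab.conn (topDer nab E C)) (branchDer nab X)

/-- The new branch is linked either within the first branch, top node included, or to an inner node
of the remaining ones; these cases give the two summands of `setSum`. Linearity of Φ in its entries
is needed because the first case yields a linear combination of trees inside one branch. -/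
lemma GraftsAsDerivative.cons {E : Der k R} {C : OTree (Der k R)} {Φ : List (Der k R) → M}
    (hΦ : ∀ n, EntryLinear k n Φ) {F : Der k R} {B U : OTree (Der k R)}
    (hB : GraftsAsDerivative nab E C (covIter nab nab.conn F) B)
    (hU : GraftsAsDerivative nab E C (fun l => Φ (topDer nab F B :: l)) U) :
    GraftsAsDerivative nab E C Φ (.cons F B U) := by
  unfold GraftsAsDerivative at *
  rw [graftIn, map_add, consL, consR, lin_comp, lin_comp]
  simp only [constr_tree, branchDer]
  rw [setSum]
  congr 1
  have h := lin_comp k (fun B => covIter nab nab.conn F (branchDer nab B))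
    ((hΦ (([] : List (Der k R)).length + (branchDer nab U).length + 1) [] (branchDer nab U)
      rfl).mk' _) (tree k (OTree.cons E C B) + graftIn k E C B)
  refine h.symm.trans ?_
  -- Linking to the top node of the first branch puts one more derivation before those of its
  -- sub-branches. The sum subtracted in that recursion is the one which `hB` gives for the nodes
  -- above, so only ∇ of the branch derivation is left.
  rw [map_add, hB, constr_tree, branchDer, covIter_cons]
  simp only [topDer, sub_add_cancel]
  rfl

/-- The target module stays fixed during an induction, while the step needs the statement inside a
branch for a map with values in derivations. Hence this case is settled first, and general targets
use it for the branches. -/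
lemma topDer_graftsAsDerivative (E : Der k R) (C X : OTree (Der k R)) :
    ∀ Φ : List (Der k R) → Der k R, (∀ n, EntryLinear k n Φ) → GraftsAsDerivative nab E C Φ X := by
  induction X with
  | nil => intro Φ _; exact map_zero _
  | cons F B U ihB ihU =>
    intro Φ hΦ
    exact .cons nab hΦ
      (ihB _ (covIter_entryLinear nab nab.isLinearMap_left nab.isLinearMap_right F))
      (ihU _ fun n => (hΦ (n + 1)).cons _)

lemma graftsAsDerivative (E : Der k R) (C X : OTree (Der k R)) :
    ∀ Φ : List (Der k R) → M, (∀ n, EntryLinear k n Φ) → GraftsAsDerivative nab E C Φ X := by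
  induction X with
  | nil => intro Φ _; exact map_zero _
  | cons F B U _ ihU =>
    intro Φ hΦ
    exact .cons nab hΦ
      (topDer_graftsAsDerivative nab E C B _
        (covIter_entryLinear nab nab.isLinearMap_left nab.isLinearMap_right F))
      (ihU _ fun n => (hΦ (n + 1)).cons _)

end Covariant

/-! ### The map to the enveloping algebra is multiplicative. -/

section Enveloping

variable {k : Type*} [Field k] {R : Type*} [CommRing R] [Algebra k R] (nab : Connection k R)

attribute [local instance] LieRing.ofAssociativeRing

/-- Multiplication by derivations in the enveloping algebra. -/
def derMul (F : Der k R) (x : UDer k R) : UDer k R := UniversalEnvelopingAlgebra.ι k F * x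

lemma treeToU_tree (T : OTree (Der k R)) :
    treeToU nab (tree k T) = covIter nab derMul 1 (branchDer nab T) :=
  constr_tree k _ T

lemma covIter_derMul_entryLinear (n : ℕ) :
    EntryLinear k n (covIter nab (derMul (k := k) (R := R)) 1) := by
  refine covIter_entryLinear nab (fun x => ⟨fun E F => ?_, fun c E => ?_⟩)
    (fun F => ⟨fun x y => mul_add _ x y, fun c x => mul_smul_comm c _ x⟩) 1 n
  · simp only [map_add, add_mul]
  · simp only [map_smul, smul_mul_assoc]

/-- The trees with the branch linked to inner nodes contribute the sum which the recursion subtracts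
from the tree with the branch linked to the root. What remains is multiplication by the derivation
of the branch. -/
lemma treeToU_graft (E : Der k R) (C : OTree (Der k R)) (x : TreeAlg k (Der k R)) :
    treeToU nab (graft k E C x) = UniversalEnvelopingAlgebra.ι k (topDer nab E C) *
      treeToU nab x := by
  suffices treeToU nab ∘ₗ graft k E C = LinearMap.mulLeft k
      (UniversalEnvelopingAlgebra.ι k (topDer nab E C)) ∘ₗ treeToU nab from
    congrArg (fun f => f x) this
  refine (treeBasis k _).ext fun X => ?_
  rw [treeBasis_apply, LinearMap.comp_apply, LinearMap.comp_apply, graft, constr_tree, map_add,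
    treeToU_tree, treeToU_tree, branchDer, covIter_cons]
  have h := graftsAsDerivative nab E C X _ (covIter_derMul_entryLinear nab)
  unfold GraftsAsDerivative at h
  have h' : treeToU nab (graftIn k E C X) = _ := h
  rw [h']
  simp only [topDer, sub_add_cancel]
  rfl

lemma mul_eq_treeMul {L : Type*} (x y : TreeAlg k L) : x * y = treeMul k L x y := rfl
lemma one_eq_tree {L : Type*} : (1 : TreeAlg k L) = tree k .nil := rfl

lemma treeToU_one : treeToU nab 1 = 1 := by
  rw [one_eq_tree, treeToU_tree, branchDer, covIter_nil]

/-- A linear map which is multiplicative for left factors `u(E; C)` is multiplicative. -/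
lemma map_mul_of_graft {L A : Type*} [Ring A] [Algebra k A] (f : TreeAlg k L →ₗ[k] A)
    (h1 : f 1 = 1) (a : L → OTree L → A)
    (h : ∀ E C x, f (graft k E C x) = a E C * f x) (x y : TreeAlg k L) :
    f (x * y) = f x * f y := by
  let P : Submodule k (TreeAlg k L) :=
    { carrier := {x | ∀ y, f (x * y) = f x * f y}
      add_mem' := fun ha hb y => by rw [add_mul, map_add, ha y, hb y, map_add, add_mul]
      zero_mem' := fun y => by simp
      smul_mem' := fun c a ha y => by
        rw [smul_mul_assoc, map_smul, ha y, map_smul, smul_mul_assoc] }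
  refine tree_induction k P ?_ ?_ x y
  · intro y
    change f (1 * y) = f 1 * f y
    rw [h1, one_mul, one_mul]
  · intro E C U hU hg y
    -- The correction `graftIn` has as many root branches as `U`, so `tree_induction` supplies the
    -- claim for both terms on the right.
    have hcons : tree k (OTree.cons E C U) = graft k E C (tree k U) - graftIn k E C U := by
      rw [graft, constr_tree, add_sub_cancel_right]
    have hy : graft k E C (tree k U) * y = graft k E C (tree k U * y) :=
      treeMul_graft k E C _ _
    rw [hcons, sub_mul, map_sub, hg y, map_sub, sub_mul, hy, h, h, hU y, mul_assoc]

/-- `treeToU` as a homomorphism of algebras. -/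
noncomputable def treeToUHom : TreeAlg k (Der k R) →ₐ[k] UDer k R :=
  AlgHom.ofLinearMap (treeToU nab) (treeToU_one nab)
    (map_mul_of_graft _ (treeToU_one nab) _ (treeToU_graft nab))

lemma relabel_graftIn {L L' : Type*} (f : L → L') (E : L) (C T : OTree L) :
    lin (k := k) (fun X => tree k (X.map f)) (graftIn k E C T) =
      graftIn k (f E) (C.map f) (T.map f) := by
  induction T with
  | nil => exact map_zero _
  | cons F B U ihB ihU =>
    simp only [graftIn, OTree.map, map_add, ← ihB, ← ihU, consL, consR, lin_comp, constr_tree]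

variable (S : Set (Der k R))

lemma treeIncl_graft (E : S) (C : OTree S) (x : TreeAlg k S) :
    treeIncl S (graft k E C x) = tree k (.u E.1 (C.map Subtype.val)) * treeIncl S x := by
  rw [mul_eq_treeMul, treeMul_u]
  suffices treeIncl S ∘ₗ graft k E C = graft k E.1 (C.map Subtype.val) ∘ₗ treeIncl S from
    congrArg (fun f => f x) this
  refine (treeBasis k _).ext fun X => ?_
  have h := relabel_graftIn (k := k) Subtype.val E C X
  have h' : treeIncl S (graftIn k E C X) = _ := h
  rw [treeBasis_apply, LinearMap.comp_apply, LinearMap.comp_apply, graft, constr_tree, map_add, h',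
    treeIncl, constr_tree, constr_tree, graft, constr_tree]
  rfl

lemma treeIncl_one : treeIncl S 1 = 1 := constr_tree k _ _

/-- `treeIncl` as a homomorphism of algebras. -/
noncomputable def treeInclHom : TreeAlg k S →ₐ[k] TreeAlg k (Der k R) :=
  AlgHom.ofLinearMap (treeIncl S) (treeIncl_one S)
    (map_mul_of_graft _ (treeIncl_one S) _ (treeIncl_graft S))

/-- `treeToUOn` as a homomorphism of algebras. -/
noncomputable def treeToUOnHom : TreeAlg k S →ₐ[k] UDer k R :=
  (treeToUHom nab).comp (treeInclHom S)

end Enveloping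

end ConnTree

namespace ConnTree

open TreeProof

/-! ### Existence and uniqueness of the action on R. -/

section Action

variable {k : Type*} [Field k] {R : Type*} [CommRing R] [Algebra k R] (nab : Connection k R)

attribute [local instance] LieRing.ofAssociativeRing

lemma ueaAct_ι (E : Der k R) :
    ueaAct k R (UniversalEnvelopingAlgebra.ι k E) = (E.toLinearMap : Module.End k R) :=
  UniversalEnvelopingAlgebra.lift_ι_apply k (derEnd k R) E

lemma treeToU_u (E : Der k R) (C : OTree (Der k R)) :
    treeToU nab (tree k (.u E C)) = UniversalEnvelopingAlgebra.ι k (topDer nab E C) := by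
  have h := treeToU_graft nab E C 1
  rwa [treeToU_one, mul_one, ← treeMul_u, ← mul_eq_treeMul, mul_one] at h

lemma treeAct_u (E : Der k R) (C : OTree (Der k R)) :
    treeAct nab (tree k (.u E C)) = (topDer nab E C).toLinearMap := by
  rw [treeAct, LinearMap.comp_apply, treeToU_u]
  exact ueaAct_ι _

lemma topDer_nil (E : Der k R) : topDer nab E .nil = E := by
  rw [topDer, branchDer, covIter_nil]

lemma topDer_v (E F : Der k R) : topDer nab E (.v F) = nab.conn F E := by
  rw [topDer, OTree.v, branchDer, branchDer, covIter_nil, covIter_cons, covIter_nil,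
    setSum, sub_zero]

/-- A branch enters `branchDer` only through its own derivation, which is also the derivation of the
leaf put in its place. -/
lemma Replace.branchDer_eq {E : Der k R} {C T T' : OTree (Der k R)}
    (h : Replace E C (topDer nab E C) T T') : branchDer nab T = branchDer nab T' := by
  generalize hG : topDer nab E C = G at h
  induction h with
  | here V => rw [branchDer, branchDer, branchDer, covIter_nil, ← hG, topDer]
  | child F V _ ih => rw [branchDer, branchDer, ih]
  | sibling F B _ ih => rw [branchDer, branchDer, ih]

lemma toLinearMap_injective :
    Function.Injective fun E : Der k R => (E.toLinearMap : Module.End k R) := fun _ _ h =>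
  Derivation.ext fun r => congrArg (fun f : Module.End k R => f r) h

theorem treeAct_isConnAction : IsConnAction nab (treeAct nab) where
  map_one := by
    rw [treeAct, LinearMap.comp_apply, treeToU_one]
    exact map_one (ueaAct k R)
  map_mul x y := map_mul ((ueaAct k R).comp (treeToUHom nab)) x y
  act_v E := by
    have h := treeAct_u nab E .nil
    rwa [topDer_nil] at h
  act_u E F := by rw [treeAct_u, topDer_v]
  coherent E C G hG T T' hT := by
    rw [treeAct_u] at hG
    -- Derivations act faithfully, so G can only be the derivation of the branch.
    obtain rfl := toLinearMap_injective hG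
    rw [treeAct, LinearMap.comp_apply, LinearMap.comp_apply, treeToU_tree, treeToU_tree,
      hT.branchDer_eq nab]

/-- The tree whose branches are the leaves labelled by a list. -/
def flat {L : Type*} : List L → OTree L
  | [] => .nil
  | F :: l => .cons F .nil (flat l)

/-- Replacing a branch `u(E; v(F₁),…,v(Fₙ))` by the leaf of its derivation. -/
def FlatStep (T T' : OTree (Der k R)) : Prop :=
  ∃ E l, Replace E (flat l) (covIter nab nab.conn E l) T T'

/-- Inside the first branch the sub-branches are reduced to leaves; the branch itself is then of the
form to which a step applies and becomes a leaf, after which its siblings are treated. -/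
lemma flatStep_branchDer (T : OTree (Der k R)) :
    Relation.ReflTransGen (FlatStep nab) T (flat (branchDer nab T)) := by
  induction T with
  | nil => exact .refl
  | cons E C V ihC ihV =>
    rw [branchDer, flat]
    have h1 := Relation.ReflTransGen.lift (r := FlatStep nab) (p := FlatStep nab)
      (fun B => OTree.cons E B V) (fun _ _ ⟨E', l, h⟩ => ⟨E', l, .child E V h⟩) _ _ ihC
    have h2 := Relation.ReflTransGen.lift (r := FlatStep nab) (p := FlatStep nab)
      (fun U => OTree.cons (topDer nab E C) .nil U)
      (fun _ _ ⟨E', l, h⟩ => ⟨E', l, .sibling _ _ h⟩) _ _ ihV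
    exact (h1.tail ⟨E, branchDer nab C, .here V⟩).trans h2

variable {nab} {ψ ψ' : TreeAlg k (Der k R) →ₗ[k] Module.End k R}

/-- Linking v(F) to a leaf X makes it u(X; v(F)), which may be replaced by the leaf ∇_F X. The map θ
is arbitrary so that it can be an action preceded by an operation that places the leaves under a
node or beside further siblings. -/
lemma map_graftIn_flat {P : Type*} [AddCommGroup P] [Module k P] (F : Der k R)
    (l : List (Der k R)) : ∀ θ : TreeAlg k (Der k R) →ₗ[k] P,
    (∀ X T T', Replace X (.v F) (nab.conn F X) T T' → θ (tree k T) = θ (tree k T')) →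
    θ (graftIn k F .nil (flat l)) = setSum (fun l' => θ (tree k (flat l'))) (nab.conn F) l := by
  induction l with
  | nil => intro θ _; exact map_zero θ
  | cons x l ih =>
    intro θ hθ
    have h2 := ih (θ ∘ₗ consR k x .nil) fun X T T' h => by
      simp only [LinearMap.comp_apply, consR, constr_tree]
      exact hθ X _ _ (.sibling _ _ h)
    simp only [LinearMap.comp_apply, consR, constr_tree] at h2
    simp only [flat, graftIn, setSum, map_add, add_zero, consL, consR, constr_tree, h2]
    congr 1
    exact hθ x _ _ (.here _)

lemma IsConnAction.replace_v (h : IsConnAction nab ψ) {F X : Der k R} {T T' : OTree (Der k R)}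
    (hT : Replace X (.v F) (nab.conn F X) T T') : ψ (tree k T) = ψ (tree k T') :=
  h.coherent X _ _ (h.act_u X F) T T' hT

lemma IsConnAction.act_graft (h : IsConnAction nab ψ) (F : Der k R)
    (x : TreeAlg k (Der k R)) :
    ψ (graft k F .nil x) = (F.toLinearMap : Module.End k R) * ψ x := by
  rw [← treeMul_u, ← mul_eq_treeMul, h.map_mul]
  exact congrArg (· * ψ x) (h.act_v F)

/-- The product v(F) · v(H) has two terms: v(F) beside v(H), and u(H; v(F)), which acts as ∇_F H. -/
lemma IsConnAction.act_cons_v (h : IsConnAction nab ψ) (F H : Der k R) :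
    ψ (tree k (.cons F .nil (.v H))) =
      (F.toLinearMap : Module.End k R) * H.toLinearMap - (nab.conn F H).toLinearMap := by
  have h1 := h.act_graft F (tree k (.v H))
  rw [graft, constr_tree, h.act_v, OTree.v, graftIn, graftIn, add_zero, map_zero,
    add_zero, consL, constr_tree, map_add] at h1
  rw [eq_sub_iff_add_eq, ← h.act_u H F]
  exact h1

/-- The product of v(F) with u(E; flat l) links F to the root, to E, or to one of the leaves. All
terms but the one with F linked to E are known from lists of the length of l, and solving for that
term gives the recursion for D. -/
lemma IsConnAction.act_u_flat (h : IsConnAction nab ψ) (n : ℕ) :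
    ∀ (E : Der k R) (l : List (Der k R)), l.length = n →
      ψ (tree k (.u E (flat l))) = (covIter nab nab.conn E l).toLinearMap := by
  induction n with
  | zero =>
    intro E l hl
    obtain rfl := List.length_eq_zero_iff.1 hl
    rw [covIter_nil]
    exact h.act_v E
  | succ n ih =>
    intro E l hl
    obtain ⟨F, l, rfl⟩ := List.exists_cons_of_length_eq_add_one hl
    have hl' : l.length = n := by simpa using hl
    have h1 := h.act_graft F (tree k (.u E (flat l)))
    have h2 := map_graftIn_flat (nab := nab) F l (ψ ∘ₗ consL k E .nil) fun X T T' hT => by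
      simp only [LinearMap.comp_apply, consL, constr_tree]
      exact h.replace_v (.child _ _ hT)
    simp only [LinearMap.comp_apply] at h2
    -- In the term with F linked to the root, the induction hypothesis and coherence turn the
    -- sibling u(E; flat l) into a leaf, so that `act_cons_v` applies to it.
    rw [graft, constr_tree, map_add, OTree.u, graftIn, graftIn, map_zero, add_zero, map_add,
      map_add, h2, h.coherent E (flat l) _ (ih E l hl') _ _ (.sibling F .nil (.here .nil))] at h1
    have h3 := h.act_cons_v F (covIter nab nab.conn E l)
    rw [OTree.v] at h3
    rw [h3] at h1
    have h4 : setSum (fun l' => ψ (consL k E .nil (tree k (flat l')))) (nab.conn F) l =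
        (setSum (covIter nab nab.conn E) (nab.conn F) l).toLinearMap := by
      refine Eq.trans (setSum_congr _ _ _ _ fun l' hl'' => ?_)
        (map_setSum (derEnd k R).toLinearMap (nab.conn F) l (covIter nab nab.conn E)).symm
      rw [consL, constr_tree]
      exact ih E l' (hl''.trans hl')
    have h5 : ψ (consL k E .nil (tree k (.cons F .nil (flat l)))) =
        ψ (tree k (.u E (flat (F :: l)))) := by rw [consL, constr_tree]; rfl
    have h6 : ψ (tree k (.cons E (flat l) .nil)) = (covIter nab nab.conn E l).toLinearMap :=
      ih E l hl'
    rw [h4, h5, h6] at h1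
    rw [covIter_cons]
    have h7 : (nab.conn F (covIter nab nab.conn E l) -
        setSum (covIter nab nab.conn E) (nab.conn F) l).toLinearMap =
        (nab.conn F (covIter nab nab.conn E l)).toLinearMap -
        (setSum (covIter nab nab.conn E) (nab.conn F) l).toLinearMap := rfl
    rw [h7, eq_sub_iff_add_eq]
    -- The composite of F with the derivation of u(E; flat l) occurs on both sides and cancels; a
    -- relation between derivations is left.
    rw [sub_add_eq_add_sub, sub_eq_iff_eq_add, add_right_inj] at h1
    exact h1

lemma IsConnAction.act_flat_branchDer (h : IsConnAction nab ψ) (T : OTree (Der k R)) :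
    ψ (tree k T) = ψ (tree k (flat (branchDer nab T))) := by
  have hT := flatStep_branchDer nab T
  generalize flat (branchDer nab T) = T' at hT ⊢
  induction hT with
  | refl => rfl
  | tail _ hs ih =>
    obtain ⟨E, l, hs⟩ := hs
    exact ih.trans (h.coherent E _ _ (h.act_u_flat _ E l rfl) _ _ hs)

/-- Same argument at the root: flat (F :: l) is v(F) · flat l minus terms which coherence turns into
trees with as many leaves as l. -/
lemma IsConnAction.eq_on_flat (h : IsConnAction nab ψ) (h' : IsConnAction nab ψ') (n : ℕ) :
    ∀ l : List (Der k R), l.length = n → ψ (tree k (flat l)) = ψ' (tree k (flat l)) := by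
  induction n with
  | zero =>
    intro l hl
    obtain rfl := List.length_eq_zero_iff.1 hl
    exact h.map_one.trans h'.map_one.symm
  | succ n ih =>
    intro l hl
    obtain ⟨F, l, rfl⟩ := List.exists_cons_of_length_eq_add_one hl
    have hl' : l.length = n := by simpa using hl
    have e : tree k (flat (F :: l)) =
        graft k F .nil (tree k (flat l)) - graftIn k F .nil (flat l) := by
      rw [graft, constr_tree, add_sub_cancel_right]; rfl
    rw [e, map_sub, map_sub, h.act_graft, h'.act_graft, ih l hl',
      map_graftIn_flat (nab := nab) F l ψ fun _ _ _ hT => h.replace_v hT,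
      map_graftIn_flat (nab := nab) F l ψ' fun _ _ _ hT => h'.replace_v hT,
      setSum_congr _ _ _ _ fun l' hl'' => ih l' (hl''.trans hl')]

theorem IsConnAction.unique (h : IsConnAction nab ψ) (h' : IsConnAction nab ψ') : ψ = ψ' :=
  (treeBasis k _).ext fun T => by
    rw [treeBasis_apply, h.act_flat_branchDer, h'.act_flat_branchDer, h.eq_on_flat h' _ _ rfl]

end Action

end ConnTree

namespace ConnTree

open TreeProof

/-! ### The coproduct and counit of trees are algebra maps. -/

section Coproduct

variable {k : Type*} [Field k] {L : Type*}

lemma treeAlg_induction {P : TreeAlg k L → Prop} (htree : ∀ T, P (tree k T)) (h0 : P 0)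
    (hadd : ∀ x y, P x → P y → P (x + y)) (hsmul : ∀ (c : k) x, P x → P (c • x))
    (x : TreeAlg k L) : P x := by
  have hx : x ∈ Submodule.span k (Set.range (treeBasis k L)) := by
    rw [(treeBasis k L).span_eq]; trivial
  induction hx using Submodule.span_induction with
  | mem x h => obtain ⟨T, rfl⟩ := h; exact htree T
  | zero => exact h0
  | add x y _ _ hx hy => exact hadd x y hx hy
  | smul c x _ hx => exact hsmul c x hx

lemma comul_tree (T : OTree L) : CoalgebraStruct.comul (R := k) (tree k T) =
    ∑ q : T.Child → Bool, tree k (T.keep q) ⊗ₜ[k] tree k (T.keep fun c => !q c) :=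
  constr_tree k _ T

lemma comul_nil : CoalgebraStruct.comul (R := k) (tree k (.nil : OTree L)) =
    tree k .nil ⊗ₜ[k] tree k .nil := by
  rw [comul_tree]
  exact Fintype.sum_unique (ι := Empty → Bool) fun _ =>
    tree k (OTree.nil : OTree L) ⊗ₜ[k] tree k (OTree.nil : OTree L)

/-- The extension `f ⊗ 1 + 1 ⊗ f` of an endomorphism to the tensor square. -/
noncomputable def leibniz {H : Type*} [AddCommGroup H] [Module k H] (f : H →ₗ[k] H) :
    H ⊗[k] H →ₗ[k] H ⊗[k] H := f.rTensor H + f.lTensor H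

/-- The mixed terms f ⊗ g and g ⊗ f arise on both sides, so the commutator relation is inherited by
the extensions to the tensor square. -/
lemma leibniz_commutator {H : Type*} [AddCommGroup H] [Module k H] {f g h : H →ₗ[k] H}
    (e : ∀ x, f (g x) = h x + g (f x)) (z : H ⊗[k] H) :
    leibniz f (leibniz g z) = leibniz h z + leibniz g (leibniz f z) := by
  induction z with
  | zero => simp
  | add x y hx hy => simp only [map_add, hx, hy]; abel
  | tmul x y =>
    simp only [leibniz, LinearMap.add_apply, map_add, LinearMap.rTensor_tmul,
      LinearMap.lTensor_tmul, e, TensorProduct.add_tmul, TensorProduct.tmul_add]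
    abel

/-- Coderivations of the coproduct of trees. -/
def IsCoderivation (f : TreeAlg k L →ₗ[k] TreeAlg k L) : Prop :=
  ∀ x, CoalgebraStruct.comul (R := k) (f x) = leibniz f (CoalgebraStruct.comul (R := k) x)

lemma isCoderivation_of_tree {f : TreeAlg k L →ₗ[k] TreeAlg k L}
    (h : ∀ T, CoalgebraStruct.comul (R := k) (f (tree k T)) =
      leibniz f (CoalgebraStruct.comul (R := k) (tree k T))) : IsCoderivation f := by
  have : (CoalgebraStruct.comul (R := k) (A := TreeAlg k L)) ∘ₗ f =
      leibniz f ∘ₗ CoalgebraStruct.comul := (treeBasis k L).ext h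
  exact fun x => congrArg (fun g => g x) this

lemma leibniz_add {H : Type*} [AddCommGroup H] [Module k H] (f g : H →ₗ[k] H)
    (z : H ⊗[k] H) : leibniz (f + g) z = leibniz f z + leibniz g z := by
  simp only [leibniz, LinearMap.rTensor_add, LinearMap.lTensor_add, LinearMap.add_apply]
  abel

lemma IsCoderivation.add {f g : TreeAlg k L →ₗ[k] TreeAlg k L} (hf : IsCoderivation f)
    (hg : IsCoderivation g) : IsCoderivation (f + g) := fun x => by
  rw [LinearMap.add_apply, map_add, hf, hg, leibniz_add]

lemma IsCoderivation.smul {f : TreeAlg k L →ₗ[k] TreeAlg k L} (hf : IsCoderivation f) (c : k) :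
    IsCoderivation (c • f) := fun x => by
  rw [LinearMap.smul_apply, map_smul, hf]
  simp only [leibniz, LinearMap.rTensor_smul, LinearMap.lTensor_smul, LinearMap.add_apply,
    LinearMap.smul_apply, smul_add]

lemma isCoderivation_zero : IsCoderivation (0 : TreeAlg k L →ₗ[k] TreeAlg k L) := fun x => by
  simp [leibniz]

lemma sum_child_cons {P : Type*} [AddCommMonoid P] {E : L} {C U : OTree L}
    (g : ((OTree.cons E C U).Child → Bool) → P) :
    ∑ q, g q = ∑ b : Bool, ∑ q : U.Child → Bool, g (fun c => Option.rec b q c) := by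
  rw [← Fintype.sum_prod_type'
    (f := fun (b : Bool) (q : U.Child → Bool) => g fun c => Option.rec b q c)]
  refine Fintype.sum_equiv (Equiv.piOptionEquivProd (α := U.Child) (β := fun _ => Bool)) _ _
    fun q => ?_
  congr 1
  funext c
  cases c <;> rfl

/-- In a distribution of the branches, the new first branch falls to the left or to the right
factor, independently of the others. -/
lemma isCoderivation_consR (E : L) (C : OTree L) : IsCoderivation (consR k E C) := by
  refine isCoderivation_of_tree fun U => ?_
  rw [consR, constr_tree, comul_tree, comul_tree, sum_child_cons, Fintype.sum_bool, leibniz,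
    LinearMap.add_apply, map_sum, map_sum]
  simp only [LinearMap.rTensor_tmul, LinearMap.lTensor_tmul, constr_tree]
  rfl

/-- `consMap F y Z` adds to `Z` a first branch labelled by `F` which carries `y`. -/
noncomputable def consMap (F : L) : TreeAlg k L →ₗ[k] TreeAlg k L →ₗ[k] TreeAlg k L :=
  lin (k := k) fun B => consR k F B

/-- Changes the point of view from an operation on the contents of the first branch to one on its
siblings; only the latter is a coderivation. -/
lemma consL_eq (F : L) (U : OTree L) (y : TreeAlg k L) :
    consL k F U y = consMap F y (tree k U) := by
  induction y using treeAlg_induction with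
  | htree B => simp only [consL, consMap, consR, constr_tree]
  | h0 => simp only [map_zero, LinearMap.zero_apply]
  | hadd x y hx hy => rw [map_add, map_add, LinearMap.add_apply, hx, hy]
  | hsmul c x hx => rw [map_smul, map_smul, LinearMap.smul_apply, hx]

lemma isCoderivation_consMap (F : L) (y : TreeAlg k L) : IsCoderivation (consMap F y) := by
  induction y using treeAlg_induction with
  | htree B => rw [consMap, constr_tree]; exact isCoderivation_consR F B
  | h0 => rw [map_zero]; exact isCoderivation_zero
  | hadd x y hx hy => rw [map_add]; exact hx.add hy
  | hsmul c x hx => rw [map_smul]; exact hx.smul c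

variable (k) in
/-- `graftIn` as a linear map. -/
noncomputable def graftInner (E : L) (C : OTree L) : TreeAlg k L →ₗ[k] TreeAlg k L :=
  lin (k := k) (graftIn k E C)

/-- The commutator of `graftInner` with adding a first branch adds the modified first branch
instead, hence is itself a coderivation. This carries the coderivation property of `graftInner` from
U to cons F B U. -/
lemma graftInner_consR (E : L) (C : OTree L) (F : L) (B : OTree L) (x : TreeAlg k L) :
    graftInner k E C (consR k F B x) =
      consMap F (tree k (.cons E C B) + graftIn k E C B) x +
        consR k F B (graftInner k E C x) := by
  induction x using treeAlg_induction with
  | htree U =>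
    rw [consR, constr_tree, graftInner, constr_tree, constr_tree, graftIn, consL_eq, consR]
  | h0 => simp only [map_zero, add_zero]
  | hadd x y hx hy => simp only [map_add, hx, hy]; abel
  | hsmul c x hx => simp only [map_smul, hx, smul_add]

lemma isCoderivation_graftInner (E : L) (C : OTree L) : IsCoderivation (graftInner k E C) := by
  refine isCoderivation_of_tree fun T => ?_
  induction T with
  | nil =>
    have e' : graftInner k E C (tree k .nil) = 0 := constr_tree k _ _
    simp only [comul_nil, e', leibniz, LinearMap.add_apply, LinearMap.rTensor_tmul,
      LinearMap.lTensor_tmul, map_zero, TensorProduct.zero_tmul, TensorProduct.tmul_zero, add_zero]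
  | cons F B U _ ih =>
    have e : tree k (.cons F B U) = consR k F B (tree k U) := by
      rw [consR, constr_tree]
    rw [e, graftInner_consR, map_add, isCoderivation_consMap, isCoderivation_consR,
      isCoderivation_consR, ih,
      leibniz_commutator (graftInner_consR E C F B) (CoalgebraStruct.comul (tree k U))]

lemma graft_eq (E : L) (C : OTree L) : graft k E C = consR k E C + graftInner k E C :=
  (treeBasis k L).ext fun T => by
    rw [treeBasis_apply, LinearMap.add_apply, graft, consR, graftInner, constr_tree, constr_tree,
      constr_tree]

lemma isCoderivation_graft (E : L) (C : OTree L) : IsCoderivation (graft k E C) := by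
  rw [graft_eq]
  exact (isCoderivation_consR E C).add (isCoderivation_graftInner E C)

variable (k) in
/-- The branch `u(E; C)` as a primitive element of the tensor square. -/
noncomputable def primTree (E : L) (C : OTree L) : TreeAlg k L ⊗[k] TreeAlg k L :=
  tree k (.u E C) ⊗ₜ 1 + 1 ⊗ₜ tree k (.u E C)

/-- Since `graft` is left multiplication by u(E; C), its extension to the tensor square is left
multiplication by the corresponding primitive element. -/
lemma comul_graft (E : L) (C : OTree L) (x : TreeAlg k L) :
    CoalgebraStruct.comul (R := k) (graft k E C x) =
      primTree k E C * CoalgebraStruct.comul (R := k) x := by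
  rw [isCoderivation_graft]
  generalize CoalgebraStruct.comul (R := k) x = z
  induction z with
  | zero => simp only [map_zero, mul_zero]
  | add x y hx hy => rw [map_add, mul_add, hx, hy]
  | tmul x y =>
    rw [leibniz, primTree, add_mul, Algebra.TensorProduct.tmul_mul_tmul,
      Algebra.TensorProduct.tmul_mul_tmul, one_mul, one_mul, LinearMap.add_apply,
      LinearMap.rTensor_tmul, LinearMap.lTensor_tmul, mul_eq_treeMul, mul_eq_treeMul, treeMul_u,
      treeMul_u]

lemma comul_one : CoalgebraStruct.comul (R := k) (1 : TreeAlg k L) = 1 := comul_nil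

variable (k L) in
/-- The coproduct of trees as a homomorphism of algebras. -/
noncomputable def treeComul : TreeAlg k L →ₐ[k] TreeAlg k L ⊗[k] TreeAlg k L :=
  AlgHom.ofLinearMap CoalgebraStruct.comul comul_one (map_mul_of_graft _ comul_one _ comul_graft)

lemma graft_one (E : L) (C : OTree L) : graft k E C 1 = tree k (.u E C) := by
  rw [← treeMul_u, ← mul_eq_treeMul, mul_one]

lemma treeComul_u (E : L) (C : OTree L) :
    treeComul k L (tree k (.u E C)) = primTree k E C := by
  have h := comul_graft (k := k) E C 1
  rwa [comul_one, mul_one, graft_one] at h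

lemma counit_one : CoalgebraStruct.counit (R := k) (1 : TreeAlg k L) = 1 := constr_tree k _ _

/-- Every tree which arises by grafting has a branch at its root. -/
lemma counit_graft (E : L) (C : OTree L) (x : TreeAlg k L) :
    CoalgebraStruct.counit (R := k) (graft k E C x) =
      (0 : k) * CoalgebraStruct.counit (R := k) x := by
  rw [zero_mul]
  have hL (F : L) (U : OTree L) (y : TreeAlg k L) :
      CoalgebraStruct.counit (R := k) (consL k F U y) = 0 := by
    induction y using treeAlg_induction with
    | htree B => rw [consL, constr_tree]; exact constr_tree k _ _
    | h0 => simp only [map_zero]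
    | hadd x y hx hy => rw [map_add, map_add, hx, hy, add_zero]
    | hsmul c x hx => rw [map_smul, map_smul, hx, smul_zero]
  have hR (F : L) (B : OTree L) (y : TreeAlg k L) :
      CoalgebraStruct.counit (R := k) (consR k F B y) = 0 := by
    induction y using treeAlg_induction with
    | htree U => rw [consR, constr_tree]; exact constr_tree k _ _
    | h0 => simp only [map_zero]
    | hadd x y hx hy => rw [map_add, map_add, hx, hy, add_zero]
    | hsmul c x hx => rw [map_smul, map_smul, hx, smul_zero]
  rw [graft_eq, LinearMap.add_apply, map_add, hR, zero_add]
  induction x using treeAlg_induction with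
  | htree T =>
    rw [graftInner, constr_tree]
    cases T with
    | nil => exact map_zero _
    | cons F B U => rw [graftIn, map_add, hL, hR, add_zero]
  | h0 => simp only [map_zero]
  | hadd x y hx hy => rw [map_add, map_add, hx, hy, add_zero]
  | hsmul c x hx => rw [map_smul, map_smul, hx, smul_zero]

variable (k L) in
/-- The counit of trees as a homomorphism of algebras. -/
noncomputable def treeCounit : TreeAlg k L →ₐ[k] k :=
  AlgHom.ofLinearMap CoalgebraStruct.counit counit_one
    (map_mul_of_graft _ counit_one (fun _ _ => 0) counit_graft)

lemma treeCounit_u (E : L) (C : OTree L) : treeCounit k L (tree k (.u E C)) = 0 := by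
  have h := counit_graft (k := k) E C 1
  rwa [zero_mul, graft_one] at h

/-- The trees `u(E; C)` generate the algebra of trees. -/
lemma treeAlgHom_ext {A : Type*} [Ring A] [Algebra k A] {f g : TreeAlg k L →ₐ[k] A}
    (h : ∀ E C, f (tree k (.u E C)) = g (tree k (.u E C))) : f = g := by
  refine AlgHom.ext fun x => ?_
  refine tree_induction k (LinearMap.eqLocus f.toLinearMap g.toLinearMap) ?_ ?_ x
  · change f 1 = g 1
    rw [map_one, map_one]
  · intro E C U hU hg
    change f _ = g _
    change f _ = g _ at hU
    change f _ = g _ at hg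
    have hcons : tree k (OTree.cons E C U) = tree k (.u E C) * tree k U - graftIn k E C U := by
      rw [mul_eq_treeMul, treeMul_u, graft, constr_tree, add_sub_cancel_right]
    rw [hcons, map_sub, map_sub, map_mul, map_mul, h, hU, hg]

end Coproduct

/-! ### Homomorphisms of smash products induced by maps of bialgebras. -/

section Smash

variable {k : Type*} [Field k] {R : Type*} [CommRing R] [Algebra k R]
  {H H' : Type*} [Ring H] [Algebra k H] [Ring H'] [Algebra k H']

lemma smash_induction {P : Smash k R H → Prop} (h0 : P 0)
    (hadd : ∀ x y, P x → P y → P (x + y)) (hs : ∀ r h, P (smash k r h)) (x : Smash k R H) :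
    P x :=
  TensorProduct.induction_on (motive := P) x h0 hs hadd

lemma smashMap_smash (f : H →ₗ[k] H') (r : R) (h : H) :
    smashMap f (smash k r h) = smash k r (f h) := rfl

variable [CoalgebraStruct k H] [CoalgebraStruct k H']

lemma exists_finset_comul (h : H) : ∃ (I : Finset (H × H)),
    CoalgebraStruct.comul (R := k) h = ∑ j ∈ I, j.1 ⊗ₜ[k] j.2 :=
  TensorProduct.exists_finset _

lemma comul_smash {ι : Type*} (I : Finset ι) (h : H) (a b : ι → H)
    (hab : CoalgebraStruct.comul (R := k) h = ∑ j ∈ I, a j ⊗ₜ[k] b j) (r : R) :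
    CoalgebraStruct.comul (R := R) (smash k r h) =
      ∑ j ∈ I, smash k 1 (a j) ⊗ₜ[R] smash k r (b j) := by
  have key : CoalgebraStruct.comul (R := R) (r ⊗ₜ[k] h) =
      ∑ j ∈ I, ((1 : R) ⊗ₜ[k] a j) ⊗ₜ[R] (r ⊗ₜ[k] b j) := by
    rw [TensorProduct.comul_tmul, hab, TensorProduct.tmul_sum, map_sum, CommSemiring.comul_apply]
    rfl
  exact key

/-- The product and coproduct at r ⋊ h depend on h through a representation of its coproduct as a
sum of tensors, and applying `f` to both factors represents the coproduct of `f h`. No bialgebra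
axioms for `H` or `H'` enter. -/
lemma isRkHom_smashMap {act : H →ₗ[k] Module.End k R} {act' : H' →ₗ[k] Module.End k R}
    (f : H →ₗ[k] H') (h1 : f 1 = 1) (hmul : ∀ x y, f (x * y) = f x * f y)
    (hact : ∀ x, act' (f x) = act x)
    (hcomul : ∀ x, TensorProduct.map f f (CoalgebraStruct.comul x) = CoalgebraStruct.comul (f x))
    (hcounit : ∀ x, CoalgebraStruct.counit (R := k) (f x) = CoalgebraStruct.counit (R := k) x) :
    IsRkHom act act' (smashMap (R := R) f) := by
  have hrep (h : H) (I : Finset (H × H))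
      (hI : CoalgebraStruct.comul (R := k) h = ∑ j ∈ I, j.1 ⊗ₜ[k] j.2) :
      CoalgebraStruct.comul (R := k) (f h) = ∑ j ∈ I, f j.1 ⊗ₜ[k] f j.2 := by
    rw [← hcomul, hI, map_sum]; rfl
  refine ⟨by rw [smashMap_smash, h1], fun x y => ?_, fun x => ?_, fun x => ?_⟩
  · induction x using smash_induction with
    | h0 => simp only [map_zero, LinearMap.zero_apply]
    | hadd x x' hx hx' => simp only [map_add, LinearMap.add_apply, hx, hx']
    | hs r h =>
      induction y using smash_induction with
      | h0 => simp only [map_zero]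
      | hadd y y' hy hy' => simp only [map_add, hy, hy']
      | hs s g =>
        obtain ⟨I, hI⟩ := exists_finset_comul (k := k) h
        rw [smashMap_smash, smashMap_smash, smashMul_smash act I h _ _ hI,
          smashMul_smash act' I (f h) _ _ (hrep h I hI), map_sum]
        simp only [smashMap_smash, hmul, hact]
  · induction x using smash_induction with
    | h0 => simp only [map_zero]
    | hadd x x' hx hx' => simp only [map_add, hx, hx']
    | hs r h =>
      obtain ⟨I, hI⟩ := exists_finset_comul (k := k) h
      rw [smashMap_smash, comul_smash I h _ _ hI, comul_smash I (f h) _ _ (hrep h I hI), map_sum]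
      rfl
  · induction x using smash_induction with
    | h0 => simp only [map_zero]
    | hadd x x' hx hx' => simp only [map_add, hx, hx']
    | hs r h =>
      have e : CoalgebraStruct.counit (R := k) (f h) • CoalgebraStruct.counit (R := R) r =
        CoalgebraStruct.counit (R := k) h • CoalgebraStruct.counit (R := R) r := by rw [hcounit]
      exact e

end Smash

end ConnTree

namespace ConnTree

open TreeProof

/-! ### The three maps and the commuting triangle. -/

section Triangle

variable {k : Type*} [Field k] {R : Type*} [CommRing R] [Algebra k R] (nab : Connection k R)
  (S : Set (Der k R))

attribute [local instance] LieRing.ofAssociativeRing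

lemma ueaComul_ι (E : Der k R) :
    ueaComul k (Der k R) (UniversalEnvelopingAlgebra.ι k E) =
      UniversalEnvelopingAlgebra.ι k E ⊗ₜ[k] 1 + 1 ⊗ₜ[k] UniversalEnvelopingAlgebra.ι k E :=
  UniversalEnvelopingAlgebra.lift_ι_apply k _ E

variable (k R) in
/-- The counit of the enveloping algebra as a homomorphism of algebras. -/
noncomputable def ueaCounit : UDer k R →ₐ[k] k :=
  UniversalEnvelopingAlgebra.lift k (0 : Der k R →ₗ⁅k⁆ k)

lemma ueaCounit_ι (E : Der k R) : ueaCounit k R (UniversalEnvelopingAlgebra.ι k E) = 0 :=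
  UniversalEnvelopingAlgebra.lift_ι_apply k _ E

lemma treeIncl_u (E : S) (C : OTree S) :
    treeInclHom S (tree k (.u E C)) = tree k (.u E.1 (C.map Subtype.val)) :=
  constr_tree k _ _

lemma treeToUOnHom_u (E : S) (C : OTree S) : treeToUOnHom nab S (tree k (.u E C)) =
    UniversalEnvelopingAlgebra.ι k (topDer nab E.1 (C.map Subtype.val)) := by
  rw [treeToUOnHom, AlgHom.comp_apply, treeIncl_u]
  exact treeToU_u nab _ _

lemma treeToUOnHom_v (E : S) : treeToUOnHom nab S (tree k (.v E)) =
    UniversalEnvelopingAlgebra.ι k E.1 := by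
  have h := treeToUOnHom_u nab S E .nil
  rwa [OTree.map, topDer_nil] at h

lemma freeToTree_ι (E : S) : freeToTree S (FreeAlgebra.ι k E) = tree k (.v E) :=
  FreeAlgebra.lift_ι_apply _ _

lemma val_freeToDiff_ι (E : S) : (freeToDiff S (FreeAlgebra.ι k E)).val =
    UniversalEnvelopingAlgebra.ι k E.1 :=
  congrArg Subtype.val (FreeAlgebra.lift_ι_apply _ E)

variable (k) in
/-- The coproduct of a free algebra as a homomorphism of algebras. -/
noncomputable def freeComul (X : Type*) :
    FreeAlgebra k X →ₐ[k] FreeAlgebra k X ⊗[k] FreeAlgebra k X :=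
  FreeAlgebra.lift k fun x => FreeAlgebra.ι k x ⊗ₜ[k] 1 + 1 ⊗ₜ[k] FreeAlgebra.ι k x

variable (k) in
/-- The counit of a free algebra as a homomorphism of algebras. -/
noncomputable def freeCounit (X : Type*) : FreeAlgebra k X →ₐ[k] k :=
  FreeAlgebra.lift k fun _ => 0

lemma freeComul_ι {X : Type*} (x : X) : freeComul k X (FreeAlgebra.ι k x) =
    FreeAlgebra.ι k x ⊗ₜ[k] 1 + 1 ⊗ₜ[k] FreeAlgebra.ι k x := FreeAlgebra.lift_ι_apply _ _

lemma freeCounit_ι {X : Type*} (x : X) : freeCounit k X (FreeAlgebra.ι k x) = 0 :=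
  FreeAlgebra.lift_ι_apply _ _

/-- Both are algebra maps on a free algebra, and the two-node tree v(E) is sent to E. -/
lemma freeToDiff_comp_val :
    (treeToUOnHom nab S).comp (freeToTree S) = (Diff k S).val.comp (freeToDiff S) := by
  refine FreeAlgebra.hom_ext (funext fun E => ?_)
  have h : treeToUOnHom nab S (freeToTree S (FreeAlgebra.ι k E)) =
      (freeToDiff S (FreeAlgebra.ι k E)).val := by
    rw [freeToTree_ι, treeToUOnHom_v, val_freeToDiff_ι]
  exact h

lemma diffAct_freeToDiff (x : FreeAlgebra k S) : diffAct S (freeToDiff S x) = freeAct S x := by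
  have : ((ueaAct k R).comp (Diff k S).val).comp (freeToDiff S) =
      FreeAlgebra.lift k fun E : S => (E.1.toLinearMap : Module.End k R) := by
    refine FreeAlgebra.hom_ext (funext fun E => ?_)
    have h : ueaAct k R (freeToDiff S (FreeAlgebra.ι k E)).val =
        FreeAlgebra.lift k (fun E : S => (E.1.toLinearMap : Module.End k R))
          (FreeAlgebra.ι k E) := by
      rw [val_freeToDiff_ι, ueaAct_ι, FreeAlgebra.lift_ι_apply]
    exact h
  exact congrArg (fun f : FreeAlgebra k S →ₐ[k] Module.End k R => f x) this

/-- Trees act through the enveloping algebra, so this follows from the triangle and the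
corresponding fact for `Diff k S`. -/
lemma treeActOn_freeToTree (x : FreeAlgebra k S) :
    treeActOn nab S (freeToTree S x) = freeAct S x := by
  rw [← diffAct_freeToDiff]
  exact congrArg (fun f : FreeAlgebra k S →ₐ[k] UDer k R => ueaAct k R (f x))
    (freeToDiff_comp_val nab S)

lemma diffPair_diffComul (x : Diff k S) :
    diffPair k S (diffComul k S x) = ueaComul k (Der k R) x.val :=
  congrArg Subtype.val
    ((AlgEquiv.ofInjective (diffPair k S) (diffPair_injective k S)).apply_symm_apply
      ((((ueaComul k (Der k R)).comp (Diff k S).val).codRestrict _ (ueaComul_mem k S)) x))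

/-- A map into `Diff k S` respects coproducts if it does so as a map into the enveloping algebra. -/
lemma map_comul_diff {H : Type*} [AddCommGroup H] [Module k H] [CoalgebraStruct k H]
    (f : H →ₗ[k] Diff k S) (g : H →ₗ[k] UDer k R) (hfg : ∀ x, (f x).val = g x)
    (hg : ∀ x, TensorProduct.map g g (CoalgebraStruct.comul x) =
      CoalgebraStruct.comul (R := k) (g x)) (x : H) :
    TensorProduct.map f f (CoalgebraStruct.comul x) = CoalgebraStruct.comul (R := k) (f x) := by
  -- Over a field the tensor square of `Diff k S` embeds in that of the enveloping algebra, where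
  -- the equation is `hg`.
  refine diffPair_injective k S ?_
  refine Eq.trans ?_ ((hg x).trans ?_)
  · generalize CoalgebraStruct.comul (R := k) x = z
    induction z with
    | zero => simp only [map_zero]
    | add x y hx hy => simp only [map_add, hx, hy]
    | tmul x y =>
      rw [TensorProduct.map_tmul, TensorProduct.map_tmul, ← hfg, ← hfg]
      rfl
  · rw [← hfg]
    exact (diffPair_diffComul S (f x)).symm

lemma freeToTree_comul (x : FreeAlgebra k S) :
    TensorProduct.map (freeToTree S).toLinearMap (freeToTree S).toLinearMap
      (CoalgebraStruct.comul x) = CoalgebraStruct.comul (R := k) (freeToTree S x) := by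
  have : (Algebra.TensorProduct.map (freeToTree S) (freeToTree S)).comp (freeComul k S) =
      (treeComul k S).comp (freeToTree S) := by
    refine FreeAlgebra.hom_ext (funext fun E => ?_)
    have h : Algebra.TensorProduct.map (freeToTree S) (freeToTree S)
        (freeComul k S (FreeAlgebra.ι k E)) = treeComul k S (freeToTree S (FreeAlgebra.ι k E)) := by
      rw [freeComul_ι, map_add, Algebra.TensorProduct.map_tmul, Algebra.TensorProduct.map_tmul,
        map_one, freeToTree_ι]
      exact (treeComul_u E .nil).symm
    exact h
  exact congrArg (fun f : FreeAlgebra k S →ₐ[k] TreeAlg k S ⊗[k] TreeAlg k S => f x) this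

lemma freeToTree_counit (x : FreeAlgebra k S) :
    CoalgebraStruct.counit (R := k) (freeToTree S x) = CoalgebraStruct.counit (R := k) x := by
  have : (treeCounit k S).comp (freeToTree S) = freeCounit k S := by
    refine FreeAlgebra.hom_ext (funext fun E => ?_)
    have h : treeCounit k S (freeToTree S (FreeAlgebra.ι k E)) =
        freeCounit k S (FreeAlgebra.ι k E) := by
      rw [freeCounit_ι, freeToTree_ι]
      exact treeCounit_u E .nil
    exact h
  exact congrArg (fun f : FreeAlgebra k S →ₐ[k] k => f x) this

/-- Each u(E; C) is primitive and goes to a derivation, which is primitive too; as all maps involved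
are algebra maps, these generators suffice. -/
lemma treeToUOn_comul (x : TreeAlg k S) :
    TensorProduct.map (treeToUOn nab S) (treeToUOn nab S) (CoalgebraStruct.comul x) =
      CoalgebraStruct.comul (R := k) (treeToUOn nab S x) := by
  have : (Algebra.TensorProduct.map (treeToUOnHom nab S) (treeToUOnHom nab S)).comp
      (treeComul k S) = (ueaComul k (Der k R)).comp (treeToUOnHom nab S) := by
    refine treeAlgHom_ext fun E C => ?_
    rw [AlgHom.comp_apply, AlgHom.comp_apply, treeComul_u, primTree, map_add,
      Algebra.TensorProduct.map_tmul, Algebra.TensorProduct.map_tmul, map_one, treeToUOnHom_u,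
      ueaComul_ι]
  exact congrArg (fun f : TreeAlg k S →ₐ[k] UDer k R ⊗[k] UDer k R => f x) this

lemma treeToUOn_counit (x : TreeAlg k S) :
    CoalgebraStruct.counit (R := k) (treeToUOn nab S x) = CoalgebraStruct.counit (R := k) x := by
  have : (ueaCounit k R).comp (treeToUOnHom nab S) = treeCounit k S := by
    refine treeAlgHom_ext fun E C => ?_
    rw [AlgHom.comp_apply, treeToUOnHom_u, treeCounit_u, ueaCounit_ι]
  exact congrArg (fun f : TreeAlg k S →ₐ[k] k => f x) this

lemma treeToUOn_freeToTree (x : FreeAlgebra k S) :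
    treeToUOn nab S (freeToTree S x) = (freeToDiff S x).val :=
  congrArg (fun f : FreeAlgebra k S →ₐ[k] UDer k R => f x) (freeToDiff_comp_val nab S)

theorem iMap_isRkHom : IsRkHom (freeAct S) (treeActOn nab S) (iMap S) :=
  isRkHom_smashMap _ (map_one (freeToTree S)) (map_mul (freeToTree S))
    (treeActOn_freeToTree nab S) (freeToTree_comul S) (freeToTree_counit S)

theorem phiMap_isRkHom :
    IsRkHom (treeActOn nab S) (ueaAct k R).toLinearMap (phiMap nab S) :=
  isRkHom_smashMap _ (map_one (treeToUOnHom nab S)) (map_mul (treeToUOnHom nab S))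
    (fun _ => rfl) (treeToUOn_comul nab S) (treeToUOn_counit nab S)

lemma val_freeToDiff_comul (x : FreeAlgebra k S) :
    TensorProduct.map ((Diff k S).val.comp (freeToDiff S)).toLinearMap
      ((Diff k S).val.comp (freeToDiff S)).toLinearMap (CoalgebraStruct.comul x) =
      CoalgebraStruct.comul (R := k) (freeToDiff S x).val := by
  have : (Algebra.TensorProduct.map ((Diff k S).val.comp (freeToDiff S))
      ((Diff k S).val.comp (freeToDiff S))).comp (freeComul k S) =
      (ueaComul k (Der k R)).comp ((Diff k S).val.comp (freeToDiff S)) := by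
    refine FreeAlgebra.hom_ext (funext fun E => ?_)
    have e : ((Diff k S).val.comp (freeToDiff S)) (FreeAlgebra.ι k E) =
        UniversalEnvelopingAlgebra.ι k E.1 := val_freeToDiff_ι S E
    have h : Algebra.TensorProduct.map ((Diff k S).val.comp (freeToDiff S))
        ((Diff k S).val.comp (freeToDiff S)) (freeComul k S (FreeAlgebra.ι k E)) =
        ueaComul k (Der k R) (((Diff k S).val.comp (freeToDiff S)) (FreeAlgebra.ι k E)) := by
      rw [freeComul_ι, map_add, Algebra.TensorProduct.map_tmul, Algebra.TensorProduct.map_tmul,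
        map_one, e, ueaComul_ι]
    exact h
  exact congrArg (fun f : FreeAlgebra k S →ₐ[k] UDer k R ⊗[k] UDer k R => f x) this

lemma val_freeToDiff_counit (x : FreeAlgebra k S) :
    ueaCounit k R (freeToDiff S x).val = freeCounit k S x := by
  have : (ueaCounit k R).comp ((Diff k S).val.comp (freeToDiff S)) = freeCounit k S := by
    refine FreeAlgebra.hom_ext (funext fun E => ?_)
    have h : ueaCounit k R (freeToDiff S (FreeAlgebra.ι k E)).val =
        freeCounit k S (FreeAlgebra.ι k E) := by
      rw [val_freeToDiff_ι, ueaCounit_ι, freeCounit_ι]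
    exact h
  exact congrArg (fun f : FreeAlgebra k S →ₐ[k] k => f x) this

theorem pMap_isRkHom : IsRkHom (freeAct S) (diffAct S) (pMap S) :=
  isRkHom_smashMap _ (map_one (freeToDiff S)) (map_mul (freeToDiff S))
    (diffAct_freeToDiff S)
    (map_comul_diff S _ ((Diff k S).val.comp (freeToDiff S)).toLinearMap (fun _ => rfl)
      (val_freeToDiff_comul S))
    (val_freeToDiff_counit S)

theorem phiDiff_isRkHom (h : ∀ x, treeToUOn nab S x ∈ Diff k S) :
    IsRkHom (treeActOn nab S) (diffAct S) (phiDiff nab S h) :=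
  isRkHom_smashMap _ (Subtype.ext (map_one (treeToUOnHom nab S)))
    (fun x y => Subtype.ext (map_mul (treeToUOnHom nab S) x y))
    (fun _ => rfl) (map_comul_diff S _ (treeToUOn nab S) (fun _ => rfl) (treeToUOn_comul nab S))
    (treeToUOn_counit nab S)

theorem phiMap_comp_iMap : phiMap nab S ∘ₗ iMap S = inclMap S ∘ₗ pMap S := by
  refine LinearMap.ext fun x => ?_
  induction x using smash_induction with
  | h0 => rw [map_zero, map_zero]
  | hadd x y hx hy => rw [map_add, map_add, hx, hy]
  | hs r h => exact congrArg (smash k r) (treeToUOn_freeToTree nab S h)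

theorem phiDiff_comp_iMap (h : ∀ x, treeToUOn nab S x ∈ Diff k S) :
    phiDiff nab S h ∘ₗ iMap S = pMap S := by
  refine LinearMap.ext fun x => ?_
  induction x using smash_induction with
  | h0 => rw [map_zero, map_zero]
  | hadd x y hx hy => rw [map_add, map_add, hx, hy]
  | hs r h' => exact congrArg (smash k r) (Subtype.ext (treeToUOn_freeToTree nab S h'))

end Triangle

/-! ### When the map takes values in `Diff k S`. -/

section Span

variable {k : Type*} [Field k] {R : Type*} [CommRing R] [Algebra k R] {nab : Connection k R}

attribute [local instance] LieRing.ofAssociativeRing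

/-- The recursion uses only `A`, ∇ on the entries, and subtraction. Stated for any target so that it
serves both for the derivations of branches and for their products in the enveloping algebra. -/
lemma covIter_mem {M : Type*} [AddCommGroup M] {A : Der k R → M → M} {m : M}
    {V : Set (Der k R)} {N : AddSubgroup M} (hV : ∀ E ∈ V, ∀ F ∈ V, nab.conn E F ∈ V)
    (hA : ∀ F ∈ V, ∀ x ∈ N, A F x ∈ N) (hm : m ∈ N) (n : ℕ) :
    ∀ l : List (Der k R), l.length = n → (∀ F ∈ l, F ∈ V) → covIter nab A m l ∈ N := by
  induction n with
  | zero =>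
    intro l hl _
    obtain rfl := List.length_eq_zero_iff.1 hl
    rwa [covIter_nil]
  | succ n ih =>
    intro l hl hlV
    obtain ⟨F, l, rfl⟩ := List.exists_cons_of_length_eq_add_one hl
    have hl' : l.length = n := by simpa using hl
    have hF : F ∈ V := hlV F List.mem_cons_self
    have hV' : ∀ G ∈ l, G ∈ V := fun G hG => hlV G (List.mem_cons_of_mem F hG)
    rw [covIter]
    refine N.sub_mem (hA F hF _ (ih l hl' hV')) (N.sum_mem fun i _ => ?_)
    refine ih _ (by rw [List.length_set, hl']) fun G hG => ?_
    rcases List.mem_or_eq_of_mem_set hG with hG | rfl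
    · exact hV' G hG
    · exact hV F hF _ (hV' _ (List.get_mem l i))

/-- ∇ is bilinear over k, so the condition on `S` extends to its k-span, which is the set of labels
stable under the recursion. -/
lemma conn_mem_span {S : Set (Der k R)}
    (hS : ∀ E ∈ S, ∀ F ∈ S, nab.conn E F ∈ Submodule.span k S) :
    ∀ E ∈ Submodule.span k S, ∀ F ∈ Submodule.span k S, nab.conn E F ∈ Submodule.span k S := by
  intro E hE F hF
  induction hF using Submodule.span_induction with
  | mem F hF =>
    induction hE using Submodule.span_induction with
    | mem E hE => exact hS E hE F hF
    | zero =>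
      rw [(nab.isLinearMap_left F).map_zero]
      exact Submodule.zero_mem _
    | add x y _ _ hx hy => rw [nab.conn_add_left]; exact Submodule.add_mem _ hx hy
    | smul c x _ hx =>
      rw [(nab.isLinearMap_left F).map_smul]
      exact Submodule.smul_mem _ c hx
  | zero =>
    rw [(nab.isLinearMap_right E).map_zero]
    exact Submodule.zero_mem _
  | add x y _ _ hx hy => rw [nab.conn_add_right]; exact Submodule.add_mem _ hx hy
  | smul c x _ hx =>
    rw [(nab.isLinearMap_right E).map_smul]
    exact Submodule.smul_mem _ c hx

theorem treeToUOn_mem_diff {S : Set (Der k R)}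
    (hS : ∀ E ∈ S, ∀ F ∈ S, nab.conn E F ∈ Submodule.span k S) (x : TreeAlg k S) :
    treeToUOn nab S x ∈ Diff k S := by
  have hV := conn_mem_span hS
  have hbr (T : OTree S) :
      ∀ F ∈ branchDer nab (T.map Subtype.val), F ∈ Submodule.span k S := by
    induction T with
    | nil => intro F hF; simp [OTree.map, branchDer] at hF
    | cons E C U ihC ihU =>
      intro F hF
      rw [OTree.map, branchDer, List.mem_cons] at hF
      rcases hF with rfl | hF
      -- Here the operator is ∇ itself, so stability of the span serves both as the condition on
      -- entries and as the one on values.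
      · exact covIter_mem (V := Submodule.span k S) (N := (Submodule.span k S).toAddSubgroup)
          hV hV (Submodule.subset_span E.2) _ _ rfl ihC
      · exact ihU F hF
  induction x using treeAlg_induction with
  | htree T =>
    have e : treeToUOn nab S (tree k T) = treeToU nab (tree k (T.map Subtype.val)) :=
      congrArg (treeToU nab) (constr_tree k _ T)
    rw [e, treeToU_tree]
    refine covIter_mem (V := Submodule.span k S)
      (N := (Subalgebra.toSubmodule (Diff k S)).toAddSubgroup) hV (fun F hF x hx => ?_)
      (Diff k S).one_mem _ _ rfl (hbr T)
    have hι : UniversalEnvelopingAlgebra.ι k F ∈ Diff k S := by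
      induction hF using Submodule.span_induction with
      | mem E hE => exact Algebra.subset_adjoin ⟨E, hE, rfl⟩
      | zero => rw [map_zero]; exact (Diff k S).zero_mem
      | add x y _ _ hx hy => rw [map_add]; exact (Diff k S).add_mem hx hy
      | smul c x _ hx => rw [map_smul]; exact (Diff k S).smul_mem hx c
    exact (Diff k S).mul_mem hι hx
  | h0 => rw [map_zero]; exact (Diff k S).zero_mem
  | hadd x y hx hy => rw [map_add]; exact (Diff k S).add_mem hx hy
  | hsmul c x hx => rw [map_smul]; exact (Diff k S).smul_mem hx c

end Span

end ConnTree

theorem theorem4p3 {k R : Type*} [Field k] [CommRing R] [Algebra k R]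
    (nab : ConnTree.Connection k R) (S : Set (Derivation k R R)) :
    -- the action of trees is the one, and the only one, which the connection determines
    (ConnTree.IsConnAction nab (ConnTree.treeAct nab) ∧
      ∀ ψ : ConnTree.TreeAlg k (Derivation k R R) →ₗ[k] Module.End k R,
        ConnTree.IsConnAction nab ψ → ψ = ConnTree.treeAct nab) ∧
    -- the three maps are homomorphisms of the smash products
    ConnTree.IsRkHom (ConnTree.freeAct S) (ConnTree.treeActOn nab S) (ConnTree.iMap S) ∧
    ConnTree.IsRkHom (ConnTree.freeAct S) (ConnTree.diffAct S) (ConnTree.pMap S) ∧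
    ConnTree.IsRkHom (ConnTree.treeActOn nab S) (ConnTree.ueaAct k R).toLinearMap
      (ConnTree.phiMap nab S) ∧
    -- the triangle commutes
    ConnTree.phiMap nab S ∘ₗ ConnTree.iMap S = ConnTree.inclMap S ∘ₗ ConnTree.pMap S ∧
    -- it commutes with `φ` valued in the smash product with `Diff k S`, whenever `φ` maps there
    (∀ h : ∀ x, ConnTree.treeToUOn nab S x ∈ ConnTree.Diff k S,
      ConnTree.IsRkHom (ConnTree.treeActOn nab S) (ConnTree.diffAct S)
        (ConnTree.phiDiff nab S h) ∧
      ConnTree.phiDiff nab S h ∘ₗ ConnTree.iMap S = ConnTree.pMap S) ∧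
    -- which it does if the connection preserves the span of `S`, as for `S` all derivations
    ((∀ E ∈ S, ∀ F ∈ S, nab.conn E F ∈ Submodule.span k S) →
      ∀ x, ConnTree.treeToUOn nab S x ∈ ConnTree.Diff k S) :=
  ⟨⟨ConnTree.treeAct_isConnAction nab, fun _ h => h.unique (ConnTree.treeAct_isConnAction nab)⟩,
    ConnTree.iMap_isRkHom nab S, ConnTree.pMap_isRkHom S, ConnTree.phiMap_isRkHom nab S,
    ConnTree.phiMap_comp_iMap nab S,
    fun h => ⟨ConnTree.phiDiff_isRkHom nab S h, ConnTree.phiDiff_comp_iMap nab S h⟩,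
    ConnTree.treeToUOn_mem_diff⟩
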